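/- Let $n$ be a natural number with prime factorization $n=p_1^{s_1}p_2^{s_2}\cdots p_k^{s_k}$, where $p_1,\dots,p_k$ are distinct primes, and let $P$ be the set of positive divisors of $n$, ordered by divisibility. It is a ranked poset, with the rank of $m\in P$ equal to $\Omega(m)$, the number of prime factors of $m$ counted with multiplicity. Let $\mathbb F$ be a field. The splitting algebra $A(P)$ over $\mathbb F$ is defined as follows. Let $E_P$ be the set of pairs $(q,p)$ of elements of $P$ such that $q$ covers $p$; the pair $e=(q,p)$ is regarded as a directed edge with tail $t(e)=q$ and head $h(e)=p$. A path is a nonempty finite sequence $\pi=(e_1,\dots,e_l)$ of edges with $h(e_i)=t(e_{i+1})$ for $1\le i<l$; its tail is $t(e_1)$ and its head is $h(e_l)$. Let $\mathbb F\langle E_P\rangle$ be the free associative algebra on $E_P$, and, with a central variable $t$, let $$(t-e_1)(t-e_2)\cdots(t-e_l)=\sum_{i\ge 0}e(\pi,i)\,t^i\in\mathbb F\langle E_P\rangle[t].$$ Then $A(P)=\mathbb F\langle E_P\rangle/R$, where $R$ is the two-sided ideal generated by all $e(\pi_1,i)-e(\pi_2,i)$ with $i\ge 0$ and $\pi_1,\pi_2$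 paths with the same tail and the same head. The ideal $R$ is homogeneous, so $A(P)=\bigoplus_{i\ge0}A(P)_i$ inherits the grading by word length from $\mathbb F\langle E_P\rangle$. Let $H(A(P),z)=\sum_{i\ge 0}\dim_{\mathbb F}(A(P)_i)\,z^i$ be its Hilbert series. Then, as formal power series in $z$, $$H(A(P),z)=\frac{1-z}{1-z\prod_{j=1}^{k}\bigl(1+s_j(1-z)\bigr)}.$$ -/

import Mathlib

/-- A rank function on a poset: minimal elements are exactly those of rank `0`, and the rank goes
up by one along every covering relation. -/
class RankedPoset (P : Type*) [PartialOrder P] where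
  rank : P → ℕ
  rank_eq_zero_iff : ∀ p : P, rank p = 0 ↔ IsMin p
  rank_covBy : ∀ p q : P, p ⋖ q → rank q = rank p + 1

/-- The edges of the Hasse diagram: pairs `(q, p)` with `p ⋖ q`, directed downwards from the tail
`q` to the head `p`. -/
structure HasseEdge (P : Type*) [PartialOrder P] where
  tail : P
  head : P
  covBy : head ⋖ tail

/-- A path in the Hasse diagram: a nonempty finite sequence of edges `e₁, …, eₙ` with
`h(eᵢ) = t(eᵢ₊₁)`. -/
structure HassePath (P : Type*) [PartialOrder P] where
  edges : List (HasseEdge P)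
  ne_nil : edges ≠ []
  chain : edges.IsChain (fun e f => e.head = f.tail)

namespace HassePath

variable {P : Type*} [PartialOrder P]

/-- The tail of a path is the tail of its first edge. -/
def tail (π : HassePath P) : P := (π.edges.head π.ne_nil).tail

/-- The head of a path is the head of its last edge. -/
def head (π : HassePath P) : P := (π.edges.getLast π.ne_nil).head

/-- Two paths are equivalent when they have the same tail and the same head. -/
def Equivalent (π₁ π₂ : HassePath P) : Prop := π₁.tail = π₂.tail ∧ π₁.head = π₂.head

end HassePath

open Polynomial in
/-- The polynomial `(t - e₁)(t - e₂)⋯(t - eₙ)` over the free algebra on the edges. The variable `t`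
is central, the edges do not commute. -/
noncomputable def edgePoly (F : Type*) [Field F] {P : Type*} [PartialOrder P]
    (l : List (HasseEdge P)) : Polynomial (FreeAlgebra F (HasseEdge P)) :=
  (l.map fun e => (X - C (FreeAlgebra.ι F e))).prod

/-- The defining relations of the splitting algebra: `e(π₁, i) = e(π₂, i)` for all equivalent paths
`π₁, π₂` and all `i`, where `e(π, i)` is the coefficient of `t ^ i` in the polynomial of `π`. -/
inductive SplittingRel (F : Type*) [Field F] (P : Type*) [PartialOrder P] :
    FreeAlgebra F (HasseEdge P) → FreeAlgebra F (HasseEdge P) → Prop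
  | coeff_eq (π₁ π₂ : HassePath P) (h : π₁.Equivalent π₂) (i : ℕ) :
      SplittingRel F P ((edgePoly F π₁.edges).coeff i) ((edgePoly F π₂.edges).coeff i)

/-- The splitting algebra `A(P)`: the free algebra on the edges of the Hasse diagram modulo the
two-sided ideal generated by all `e(π₁, i) - e(π₂, i)` with `π₁, π₂` equivalent paths. -/
abbrev SplittingAlgebra (F : Type*) [Field F] (P : Type*) [PartialOrder P] : Type _ :=
  RingQuot (SplittingRel F P)

/-- The span of the words of length `i` in the free algebra on the edges. -/
def freeDegree (F : Type*) [Field F] (P : Type*) [PartialOrder P] (i : ℕ) :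
    Submodule F (FreeAlgebra F (HasseEdge P)) :=
  Submodule.span F (Set.range (FreeAlgebra.ι F)) ^ i

/-- The homogeneous component of degree `i` of `A(P)`: the image of the span of the words of
length `i` under the quotient map. -/
def splittingDegree (F : Type*) [Field F] (P : Type*) [PartialOrder P] (i : ℕ) :
    Submodule F (SplittingAlgebra F P) :=
  (freeDegree F P i).map (RingQuot.mkAlgHom F (SplittingRel F P)).toLinearMap

/-- The Hilbert series `∑ dim(Aᵢ) zⁱ` of a graded algebra with finite-dimensional components. -/
noncomputable def hilbertSeries {F A : Type*} [Field F] [Ring A] [Algebra F A]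
    (𝒜 : ℕ → Submodule F A) [GradedAlgebra 𝒜] [∀ i, Module.Finite F (𝒜 i)] : PowerSeries ℚ :=
  PowerSeries.mk fun i => (Module.finrank F (𝒜 i) : ℚ)

section Grading

variable (F : Type*) [Field F] (P : Type*) [PartialOrder P]

instance HasseEdge.instFinite [Finite P] : Finite (HasseEdge P) :=
  Finite.of_injective (fun e : HasseEdge P => (e.tail, e.head)) (by
    rintro ⟨a, b, h⟩ ⟨c, d, h'⟩ hh
    simp only [Prod.mk.injEq] at hh
    obtain ⟨rfl, rfl⟩ := hh
    rfl)

instance splittingDegree_finite [Finite P] (i : ℕ) :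
    Module.Finite F (splittingDegree F P i) := by
  rw [Module.Finite.iff_fg]
  exact Submodule.FG.map _ (Submodule.FG.pow (Submodule.fg_span (Set.finite_range _)) i)

theorem edgePoly_coeff_mem {P : Type*} [PartialOrder P] (l : List (HasseEdge P)) :
    (∀ i j : ℕ, i + j = l.length → (edgePoly F l).coeff i ∈ freeDegree F P j) ∧
      (∀ i : ℕ, l.length < i → (edgePoly F l).coeff i = 0) := by
  induction l with
  | nil =>
    constructor
    · intro i j h
      simp only [List.length_nil, Nat.add_eq_zero_iff] at h
      obtain ⟨rfl, rfl⟩ := h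
      simp only [edgePoly, List.map_nil, List.prod_nil, Polynomial.coeff_one_zero, freeDegree,
        pow_zero]
      exact Submodule.one_le.mp le_rfl
    · intro i h
      simp only [List.length_nil] at h
      simp [edgePoly, Polynomial.coeff_one, h.ne']
  | cons e l ih =>
    obtain ⟨ih1, ih2⟩ := ih
    have hι : FreeAlgebra.ι F e ∈ Submodule.span F (Set.range (FreeAlgebra.ι F)) :=
      Submodule.subset_span ⟨e, rfl⟩
    have hp : edgePoly F (e :: l) =
        Polynomial.X * edgePoly F l - Polynomial.C (FreeAlgebra.ι F e) * edgePoly F l := by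
      simp [edgePoly, sub_mul]
    have hmul : ∀ j x, x ∈ freeDegree F P j →
        FreeAlgebra.ι F e * x ∈ freeDegree F P (j + 1) := by
      intro j x hx
      unfold freeDegree at hx ⊢
      rw [pow_succ']
      exact Submodule.mul_mem_mul hι hx
    constructor
    · intro i j h
      simp only [List.length_cons] at h
      rw [hp]
      cases i with
      | zero =>
        obtain rfl : j = l.length + 1 := by omega
        simp only [Polynomial.coeff_sub, Polynomial.coeff_X_mul_zero, Polynomial.coeff_C_mul,
          zero_sub]
        exact Submodule.neg_mem _ (hmul _ _ (ih1 0 l.length (by omega)))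
      | succ i =>
        simp only [Polynomial.coeff_sub, Polynomial.coeff_X_mul, Polynomial.coeff_C_mul]
        refine Submodule.sub_mem _ (ih1 i j (by omega)) ?_
        cases j with
        | zero => rw [ih2 (i + 1) (by omega), mul_zero]; exact Submodule.zero_mem _
        | succ j => exact hmul _ _ (ih1 (i + 1) j (by omega))
    · intro i h
      simp only [List.length_cons] at h
      rw [hp]
      cases i with
      | zero => omega
      | succ i =>
        simp only [Polynomial.coeff_sub, Polynomial.coeff_X_mul, Polynomial.coeff_C_mul]
        rw [ih2 i (by omega), ih2 (i + 1) (by omega)]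
        simp

theorem HassePath.rank_tail {P : Type*} [PartialOrder P] [RankedPoset P] :
    ∀ (l : List (HasseEdge P)) (h : l ≠ []),
      l.IsChain (fun e f => e.head = f.tail) →
      RankedPoset.rank (l.head h).tail = RankedPoset.rank (l.getLast h).head + l.length
  | [], h, _ => absurd rfl h
  | [e], _, _ => by simpa using RankedPoset.rank_covBy _ _ e.covBy
  | e :: f :: l, _, hc => by
    rw [List.isChain_cons_cons] at hc
    have ih := HassePath.rank_tail (f :: l) (by simp) hc.2
    have he := RankedPoset.rank_covBy _ _ e.covBy
    simp only [List.head_cons, List.getLast_cons_cons, List.length_cons, hc.1] at ih he ⊢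
    omega

theorem HassePath.Equivalent.length_eq {P : Type*} [PartialOrder P] [RankedPoset P]
    {π₁ π₂ : HassePath P} (h : π₁.Equivalent π₂) : π₁.edges.length = π₂.edges.length := by
  have h1 := HassePath.rank_tail π₁.edges π₁.ne_nil π₁.chain
  have h2 := HassePath.rank_tail π₂.edges π₂.ne_nil π₂.chain
  have ht := congrArg RankedPoset.rank h.1
  have hh := congrArg RankedPoset.rank h.2
  simp only [HassePath.tail, HassePath.head] at ht hh
  omega

instance splittingDegree_gradedMonoid : SetLike.GradedMonoid (splittingDegree F P) where
  one_mem := ⟨1, by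
    simp only [freeDegree, pow_zero]
    exact Submodule.one_le.mp le_rfl, by simp⟩
  mul_mem := by
    rintro i j _ _ ⟨x, hx, rfl⟩ ⟨y, hy, rfl⟩
    refine ⟨x * y, ?_, by simp⟩
    have := Submodule.mul_mem_mul hx hy
    simp only [freeDegree] at this ⊢
    rwa [pow_add]

theorem mk_mem_splittingDegree {i : ℕ} {x : FreeAlgebra F (HasseEdge P)}
    (hx : x ∈ freeDegree F P i) :
    RingQuot.mkAlgHom F (SplittingRel F P) x ∈ splittingDegree F P i := ⟨x, hx, rfl⟩

theorem ι_mem_freeDegree (e : HasseEdge P) : FreeAlgebra.ι F e ∈ freeDegree F P 1 := by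
  simp only [freeDegree, pow_one]
  exact Submodule.subset_span ⟨e, rfl⟩

open DirectSum in
/-- Auxiliary map from the free algebra used to decompose `A(P)` into its components. -/
noncomputable def freeDecompose :
    FreeAlgebra F (HasseEdge P) →ₐ[F] ⨁ i, splittingDegree F P i :=
  FreeAlgebra.lift F fun e =>
    DirectSum.of (fun i => splittingDegree F P i) 1
      ⟨_, mk_mem_splittingDegree F P (ι_mem_freeDegree F P e)⟩

theorem freeDecompose_apply {i : ℕ} {x : FreeAlgebra F (HasseEdge P)}
    (hx : x ∈ freeDegree F P i) :
    freeDecompose F P x = DirectSum.of (fun i => splittingDegree F P i) i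
      ⟨_, mk_mem_splittingDegree F P hx⟩ := by
  have key : ∀ (i : ℕ) (x : FreeAlgebra F (HasseEdge P)), x ∈ freeDegree F P i →
      ∀ y : splittingDegree F P i, (y : SplittingAlgebra F P) = RingQuot.mkAlgHom F _ x →
      freeDecompose F P x = DirectSum.of (fun i => splittingDegree F P i) i y := by
    intro i x hx
    unfold freeDegree at hx
    induction hx using Submodule.pow_induction_on_left' with
    | algebraMap r =>
      intro y hy
      rw [AlgHom.commutes, DirectSum.algebraMap_apply]
      congr 1
      apply Subtype.ext
      rw [hy, AlgHom.commutes]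
      rfl
    | add x y i hx hy ihx ihy =>
      intro w hw
      rw [map_add, ihx ⟨_, mk_mem_splittingDegree F P hx⟩ rfl,
        ihy ⟨_, mk_mem_splittingDegree F P hy⟩ rfl, ← map_add]
      congr 1
      apply Subtype.ext
      rw [hw, map_add]
      rfl
    | mem_mul m hm i x hx ih =>
      have hm1 : m ∈ freeDegree F P 1 := by simpa [freeDegree] using hm
      have hfm : freeDecompose F P m = DirectSum.of (fun i => splittingDegree F P i) 1
          ⟨_, mk_mem_splittingDegree F P hm1⟩ := by
        clear ih
        induction hm using Submodule.span_induction with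
        | mem m hm =>
          obtain ⟨e, rfl⟩ := hm
          simp [freeDecompose]
        | zero =>
          rw [map_zero]
          symm
          convert map_zero (DirectSum.of (fun i => splittingDegree F P i) 1)
          simp
        | add a b ha hb iha ihb =>
          rw [map_add, iha (by simpa [freeDegree] using ha), ihb (by simpa [freeDegree] using hb),
            ← map_add]
          congr 1
          apply Subtype.ext
          simp
        | smul c a ha iha =>
          rw [map_smul, iha (by simpa [freeDegree] using ha)]
          change c • DirectSum.lof F ℕ (fun i => splittingDegree F P i) 1 _ =
            DirectSum.lof F ℕ (fun i => splittingDegree F P i) 1 _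
          rw [← map_smul]
          congr 1
          apply Subtype.ext
          simp
      intro y hy
      rw [map_mul, hfm, ih ⟨_, mk_mem_splittingDegree F P hx⟩ rfl, DirectSum.of_mul_of]
      refine DirectSum.of_eq_of_gradedMonoid_eq (Sigma.subtype_ext (add_comm _ _) ?_)
      exact (hy.trans (map_mul _ _ _)).symm
  exact key i x hx _ rfl

theorem freeDecompose_rel [RankedPoset P] {x y : FreeAlgebra F (HasseEdge P)}
    (h : SplittingRel F P x y) : freeDecompose F P x = freeDecompose F P y := by
  have hq := RingQuot.mkAlgHom_rel F h
  obtain ⟨π₁, π₂, hπ, i⟩ := h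
  have hl := hπ.length_eq
  by_cases hi : i ≤ π₁.edges.length
  · obtain ⟨j, hj⟩ := Nat.exists_eq_add_of_le hi
    rw [freeDecompose_apply F P ((edgePoly_coeff_mem F π₁.edges).1 i j hj.symm),
      freeDecompose_apply F P ((edgePoly_coeff_mem F π₂.edges).1 i j (by omega))]
    congr 1
    exact Subtype.ext hq
  · rw [(edgePoly_coeff_mem F π₁.edges).2 i (by omega),
      (edgePoly_coeff_mem F π₂.edges).2 i (by omega)]

/-- For a ranked poset, the defining relations of `A(P)` are homogeneous, so that `A(P)` is graded
by the images of the homogeneous components of the free algebra. -/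
noncomputable instance splittingDegree_gradedAlgebra [RankedPoset P] :
    GradedAlgebra (splittingDegree F P) :=
  GradedAlgebra.ofAlgHom (splittingDegree F P)
    (RingQuot.liftAlgHom F ⟨freeDecompose F P, fun _ _ h => freeDecompose_rel F P h⟩)
    (by
      apply RingQuot.ringQuot_ext'
      apply FreeAlgebra.hom_ext
      funext e
      simp [freeDecompose])
    (by
      rintro i ⟨_, x, hx, rfl⟩
      simp only [AlgHom.toLinearMap_apply, RingQuot.liftAlgHom_mkAlgHom_apply]
      exact freeDecompose_apply F P hx)

end Grading

/-- The factors of `n`. -/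
structure Factors (n : ℕ) where
  val : ℕ
  mem : val ∈ n.divisors

namespace Factors

variable {n : ℕ}

theorem ext_val {a b : Factors n} (h : a.val = b.val) : a = b := by
  cases a; cases b; simp_all

/-- The factors of `n` are ordered by divisibility. -/
instance : PartialOrder (Factors n) where
  le a b := a.val ∣ b.val
  le_refl a := dvd_rfl
  le_trans _ _ _ := dvd_trans
  le_antisymm _ _ h₁ h₂ := ext_val (Nat.dvd_antisymm h₁ h₂)

instance : Finite (Factors n) :=
  Finite.of_injective (fun a : Factors n => (⟨a.val, a.mem⟩ : n.divisors))
    fun _ _ h => ext_val (congrArg Subtype.val h)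

theorem val_ne_zero (a : Factors n) : a.val ≠ 0 := (Nat.pos_of_mem_divisors a.mem).ne'

/-- The rank of a factor `m` is `Ω(m)`, the number of its prime factors counted with
multiplicity. -/
instance : RankedPoset (Factors n) where
  rank a := ArithmeticFunction.cardFactors a.val
  rank_eq_zero_iff a := by
    rw [ArithmeticFunction.cardFactors_eq_zero_iff_eq_zero_or_one]
    constructor
    · rintro (h | h)
      · exact absurd h a.val_ne_zero
      · intro b _
        change a.val ∣ b.val
        rw [h]
        exact one_dvd _
    · intro h
      have h1 : (⟨1, Nat.one_mem_divisors.2 (Nat.mem_divisors.1 a.mem).2⟩ : Factors n) ≤ a :=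
        one_dvd a.val
      exact Or.inr (Nat.dvd_one.1 (h h1))
  rank_covBy a b h := by
    obtain ⟨m, hm⟩ : a.val ∣ b.val := h.le
    have hm1 : m ≠ 1 := by
      rintro rfl
      exact h.ne (ext_val (by simpa using hm.symm))
    obtain ⟨q, hq, r, rfl⟩ := Nat.exists_prime_and_dvd hm1
    have hdvd : a.val * q ∣ b.val := ⟨r, by rw [hm, mul_assoc]⟩
    let c : Factors n := ⟨a.val * q, Nat.mem_divisors.2
      ⟨hdvd.trans (Nat.mem_divisors.1 b.mem).1, (Nat.mem_divisors.1 b.mem).2⟩⟩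
    have hac : a < c := by
      refine lt_of_le_of_ne (Dvd.intro q rfl) fun hh => ?_
      have h2 : a.val = a.val * q := congrArg Factors.val hh
      exact hq.ne_one (Nat.eq_of_mul_eq_mul_left (Nat.pos_of_ne_zero a.val_ne_zero)
        (by rw [mul_one]; exact h2.symm))
    have hcb : c = b := by
      rcases (show c ≤ b from hdvd).lt_or_eq with hlt | heq
      · exact absurd hlt (h.2 hac)
      · exact heq
    have h3 : b.val = a.val * q := (congrArg Factors.val hcb).symm
    rw [h3, ArithmeticFunction.cardFactors_mul a.val_ne_zero hq.ne_zero,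
      ArithmeticFunction.cardFactors_apply_prime hq]

end Factors

/-! For a vertex v let P_v be the product of the t - e along any path from the top ⊤ to v, and x_v
its subleading coefficient (`DescentSystem.vertex`). Each edge is x_tail - x_head, so the x_v with v
≠ ⊤ generate A, and A_{m+1} is the image of vectors over A_m under `eval`, y ↦ Σ y_w x_w. The
Hilbert series is thus governed by the left linear relations between the x_w.

If u and u' cover v, then P_u (t - x_u + x_v) = P_u' (t - x_u' + x_v). Hence every d in the left
ideal J_v (`coverIdeal`) generated by the coefficients of all such P_u - P_u' satisfies a relation
expressing d x_v through x_w of smaller corank. These relations (`rel`, `relSpan`) generate all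
others, by a triangular matrix representation of A (`mem_relSpan_of_eval_eq_zero`), and those of
vertices of corank at most k already generate every homogeneous relation supported there
(`mem_relSpan_of_mem_vanishing`). So J_v is in each degree the space of leading coefficients at v,
and H(A) = 1 + z Σ_{v ≠ ⊤} H(A/J_v) (`hilbertSeries_eq`).

To find H(A/J_v), fix v and let D_k be the left ideal generated by the differences x_u - x_u' of
elements of corank k above v. In a `Uniform` poset D_k is also the sum of the J_u with u ≥ v of
corank k + 1 (`iSup_coverIdeal_eq`). The operator `shift` lifts right multiplication by x_u on every
J_u at once, which leads to H(A/D_{k+1}) = H(A) - z Σ H(A/J_u) + z H(A/D_k), the sum over the same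
u. As D_k = 0 for k = 0 and k = corank v, this is a triangular linear system for the H(A/J_u)
(`sum_quotSeries_coverIdeal`).

For the divisors of n the solution is (1 - z) H(A/J_v) = (1 - z)^ω(n/v) H(A) for v ≠ ⊤, because
Σ_{ab = d} z^Ω(a) (1 - z)^ω(b) = 1. Summing over v turns Σ_{d ∣ n} (1 - z)^ω(d) into the product of
the 1 + s_j (1 - z). -/

set_option linter.unusedSectionVars false

/-! ### Covers and coranks in a ranked poset with a largest element. -/

namespace RankedPoset

section Covers

variable {P : Type*} [PartialOrder P] [OrderTop P] [Finite P]

theorem exists_covBy_of_ne_top {v : P} (hv : v ≠ ⊤) : ∃ u, v ⋖ u :=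
  (IsStronglyAtomic.exists_covBy_le_of_lt v ⊤ (lt_top_iff_ne_top.2 hv)).imp fun _ h => h.1

/-- A chosen edge with head `v`. -/
noncomputable def upperEdge (v : P) (hv : v ≠ ⊤) : HasseEdge P :=
  ⟨(exists_covBy_of_ne_top hv).choose, v, (exists_covBy_of_ne_top hv).choose_spec⟩

@[simp] theorem upperEdge_head (v : P) (hv : v ≠ ⊤) : (upperEdge v hv).head = v := rfl

/-- Induction from the largest element downwards along chosen edges. -/
theorem upperEdge_induction {motive : P → Prop} (top : motive ⊤)
    (step : ∀ v (hv : v ≠ ⊤), motive (upperEdge v hv).tail → motive v) (v : P) : motive v := by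
  induction v using WellFoundedGT.induction with
  | ind v ih =>
    by_cases hv : v = ⊤
    · rwa [hv]
    · exact step v hv (ih _ (upperEdge v hv).covBy.lt)

end Covers

variable {P : Type*} [PartialOrder P] [OrderTop P] [RankedPoset P]

/-- The corank of an element of a ranked poset with a largest element. -/
def corank (v : P) : ℕ := rank (⊤ : P) - rank v

@[simp] theorem corank_top : corank (⊤ : P) = 0 := Nat.sub_self _

variable [Finite P]

theorem rank_le_rank_top (v : P) : rank v ≤ rank (⊤ : P) := by
  induction v using WellFoundedGT.induction with
  | ind v ih =>
    by_cases hv : v = ⊤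
    · rw [hv]
    · obtain ⟨u, hu⟩ := exists_covBy_of_ne_top hv
      have := ih u hu.lt
      have := rank_covBy _ _ hu
      omega

theorem corank_covBy {v u : P} (h : v ⋖ u) : corank v = corank u + 1 := by
  have := rank_covBy _ _ h
  have := rank_le_rank_top u
  unfold corank
  omega

theorem corank_eq_zero_iff {v : P} : corank v = 0 ↔ v = ⊤ := by
  refine ⟨fun h => ?_, fun h => h ▸ corank_top⟩
  by_contra hv
  obtain ⟨u, hu⟩ := exists_covBy_of_ne_top hv
  have := corank_covBy hu
  omega

theorem corank_pos {v : P} (h : v ≠ ⊤) : 0 < corank v :=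
  Nat.pos_of_ne_zero fun h' => h (corank_eq_zero_iff.1 h')

theorem corank_edge (e : HasseEdge P) : corank e.head = corank e.tail + 1 := corank_covBy e.covBy

theorem edge_head_ne_top (e : HasseEdge P) : e.head ≠ ⊤ := fun h => by
  have := corank_edge e
  rw [h, corank_top] at this
  omega

end RankedPoset

/-! ### Vertex polynomials and the universal property of the splitting algebra. -/

namespace SplittingAlgebra

open Polynomial RankedPoset

section Basic

variable (F : Type*) [Field F] {P : Type*} [PartialOrder P]

/-- The class of an edge in the splitting algebra. -/
noncomputable def edge (e : HasseEdge P) : SplittingAlgebra F P :=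
  RingQuot.mkAlgHom F (SplittingRel F P) (FreeAlgebra.ι F e)

/-- The polynomial `(t - e₁)⋯(t - eₗ)` over the splitting algebra. -/
noncomputable def pathPoly (l : List (HasseEdge P)) : (SplittingAlgebra F P)[X] :=
  (l.map fun e => X - C (edge F e)).prod

theorem map_edgePoly {B : Type*} [Ring B] [Algebra F B] (f : FreeAlgebra F (HasseEdge P) →ₐ[F] B)
    (l : List (HasseEdge P)) :
    (edgePoly F l).map (f : FreeAlgebra F (HasseEdge P) →+* B) =
      (l.map fun e => X - C (f (FreeAlgebra.ι F e))).prod := by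
  induction l with
  | nil => simp [edgePoly]
  | cons e l ih =>
    simp only [edgePoly, List.map_cons, List.prod_cons, Polynomial.map_mul] at ih ⊢
    rw [ih]
    simp

theorem pathPoly_eq_map (l : List (HasseEdge P)) : pathPoly F l =
    (edgePoly F l).map (RingQuot.mkAlgHom F (SplittingRel F P) : _ →+* SplittingAlgebra F P) :=
  (map_edgePoly F _ l).symm

theorem pathPoly_eq_of_equivalent {π₁ π₂ : HassePath P} (h : π₁.Equivalent π₂) :
    pathPoly F π₁.edges = pathPoly F π₂.edges := by
  ext i
  rw [pathPoly_eq_map, pathPoly_eq_map, coeff_map, coeff_map]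
  exact RingQuot.mkAlgHom_rel F (SplittingRel.coeff_eq π₁ π₂ h i)

variable [OrderTop P]

/-- `IsDescent l v` says that `l` is a possibly empty path from the largest element to `v`. -/
inductive IsDescent : List (HasseEdge P) → P → Prop
  | nil : IsDescent [] ⊤
  | snoc (l : List (HasseEdge P)) (e : HasseEdge P) (h : IsDescent l e.tail) :
      IsDescent (l ++ [e]) e.head

theorem IsDescent.spec {l : List (HasseEdge P)} {v : P} (h : IsDescent l v) :
    l.IsChain (fun e f => e.head = f.tail) ∧ (l = [] → v = ⊤) ∧
      ∀ hl : l ≠ [], (l.head hl).tail = ⊤ ∧ (l.getLast hl).head = v := by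
  induction h with
  | nil => simp
  | snoc l e h ih =>
    obtain ⟨h1, h2, h3⟩ := ih
    by_cases hl : l = []
    · subst hl
      simpa using h2 rfl
    · obtain ⟨h4, h5⟩ := h3 hl
      refine ⟨?_, by simp, fun _ => ⟨?_, by simp⟩⟩
      · rw [List.isChain_append]
        refine ⟨h1, by simp, ?_⟩
        intro a ha b hb
        rw [List.getLast?_eq_getLast_of_ne_nil hl] at ha
        simp only [Option.mem_def, Option.some.injEq, List.head?_cons] at ha hb
        rw [← ha, ← hb, h5]
      · rw [List.head_append_of_ne_nil hl]
        exact h4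

theorem IsDescent.pathPoly_eq {l l' : List (HasseEdge P)} {v : P} (h : IsDescent l v)
    (h' : IsDescent l' v) (hl : l ≠ []) (hl' : l' ≠ []) : pathPoly F l = pathPoly F l' := by
  obtain ⟨h1, -, h3⟩ := h.spec
  obtain ⟨h1', -, h3'⟩ := h'.spec
  exact pathPoly_eq_of_equivalent F (π₁ := ⟨l, hl, h1⟩) (π₂ := ⟨l', hl', h1'⟩)
    ⟨(h3 hl).1.trans (h3' hl').1.symm, (h3 hl).2.trans (h3' hl').2.symm⟩

variable [Finite P]

theorem exists_isDescent (v : P) : ∃ l, IsDescent l v := by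
  induction v using upperEdge_induction with
  | top => exact ⟨_, .nil⟩
  | step v hv ih =>
    obtain ⟨l, hl⟩ := ih
    exact ⟨_, .snoc l (upperEdge v hv) hl⟩

/-- Monic polynomials can be cancelled on the left even over a noncommutative ring; this is what
`exists_lift` needs. The family is arbitrary since the polynomials there live over the target ring.
-/
theorem monic_of_descent {B : Type*} [Ring B] {f : HasseEdge P → B} {q : P → B[X]}
    (htop : q ⊤ = 1) (hq : ∀ e, q e.head = q e.tail * (X - C (f e))) (v : P) : (q v).Monic := by
  induction v using upperEdge_induction with
  | top => rw [htop]; exact monic_one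
  | step v hv ih =>
    have := hq (upperEdge v hv)
    rw [upperEdge_head] at this
    rw [this]
    exact ih.mul (monic_X_sub_C _)

/-- The universal property of the splitting algebra of a poset with a largest element. -/
theorem exists_lift {B : Type*} [Ring B] [Algebra F B] {f : HasseEdge P → B} {q : P → B[X]}
    (htop : q ⊤ = 1) (hq : ∀ e, q e.head = q e.tail * (X - C (f e))) :
    ∃ ψ : SplittingAlgebra F P →ₐ[F] B, ∀ e, ψ (edge F e) = f e := by
  -- Along any path, starting anywhere, `q` is multiplied on the right by the product of the linear
  -- factors.
  have key : ∀ (l : List (HasseEdge P)) (hl : l ≠ []),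
      l.IsChain (fun e f => e.head = f.tail) →
      q (l.getLast hl).head = q (l.head hl).tail * (l.map fun e => X - C (f e)).prod := by
    intro l
    induction l with
    | nil => intro hl; exact absurd rfl hl
    | cons e l ih =>
      intro _ hc
      cases l with
      | nil => simpa using hq e
      | cons e' l =>
        rw [List.isChain_cons_cons] at hc
        have := ih (by simp) hc.2
        rw [List.getLast_cons_cons, this, List.head_cons, List.head_cons, ← hc.1, hq e,
          List.map_cons (l := e' :: l), List.prod_cons, mul_assoc]
  suffices hrel : ∀ ⦃a b⦄, SplittingRel F P a b → FreeAlgebra.lift F f a = FreeAlgebra.lift F f b by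
    refine ⟨RingQuot.liftAlgHom F ⟨FreeAlgebra.lift F f, hrel⟩, fun e => ?_⟩
    rw [edge, RingQuot.liftAlgHom_mkAlgHom_apply, FreeAlgebra.lift_ι_apply]
  rintro _ _ ⟨π₁, π₂, h, i⟩
  have h1 := key π₁.edges π₁.ne_nil π₁.chain
  have h2 := key π₂.edges π₂.ne_nil π₂.chain
  have h3 : q (π₁.edges.getLast π₁.ne_nil).head = q (π₂.edges.getLast π₂.ne_nil).head :=
    congrArg q h.2
  have h4 : q (π₁.edges.head π₁.ne_nil).tail = q (π₂.edges.head π₂.ne_nil).tail :=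
    congrArg q h.1
  rw [h1, h2, h4] at h3
  -- Equivalent paths share their tail, so its monic polynomial cancels and the two path products
  -- agree.
  have h5 := (monic_of_descent htop hq _).isRegular.left h3
  have h6 := map_edgePoly F (FreeAlgebra.lift F f) π₁.edges
  have h7 := map_edgePoly F (FreeAlgebra.lift F f) π₂.edges
  simp only [FreeAlgebra.lift_ι_apply] at h6 h7
  rw [← h6, ← h7] at h5
  simpa using congrArg (fun p => p.coeff i) h5

variable [RankedPoset P]

theorem IsDescent.length_eq {l : List (HasseEdge P)} {v : P} (h : IsDescent l v) :
    l.length = corank v := by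
  induction h with
  | nil => simp
  | snoc l e h ih => simp [ih, corank_edge]

/-- The polynomial of any path from the largest element to `v`. -/
noncomputable def vertexPoly (v : P) : (SplittingAlgebra F P)[X] :=
  pathPoly F (exists_isDescent v).choose

@[simp] theorem vertexPoly_top : vertexPoly F (⊤ : P) = 1 := by
  have h := (exists_isDescent (⊤ : P)).choose_spec.length_eq
  rw [corank_top, List.length_eq_zero_iff] at h
  simp [vertexPoly, h, pathPoly]

/-- Appending `e` to the chosen path to its tail gives a path to its head, with the same polynomial
as the one chosen there. -/
theorem vertexPoly_head (e : HasseEdge P) :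
    vertexPoly F e.head = vertexPoly F e.tail * (X - C (edge F e)) := by
  have h := (exists_isDescent e.head).choose_spec
  have h' := IsDescent.snoc _ e (exists_isDescent e.tail).choose_spec
  have hne : (exists_isDescent e.head).choose ≠ [] := by
    rw [← List.length_pos_iff, h.length_eq]
    exact corank_pos (edge_head_ne_top e)
  rw [vertexPoly, h.pathPoly_eq F h' hne (by simp)]
  simp [pathPoly, vertexPoly]

theorem natDegree_of_descent {B : Type*} [Ring B] [Nontrivial B] {f : HasseEdge P → B}
    {q : P → B[X]} (htop : q ⊤ = 1) (hq : ∀ e, q e.head = q e.tail * (X - C (f e))) (v : P) :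
    (q v).natDegree = corank v := by
  induction v using upperEdge_induction with
  | top => simp [htop]
  | step v hv ih =>
    have := hq (upperEdge v hv)
    rw [upperEdge_head] at this
    have hc := corank_edge (upperEdge v hv)
    rw [upperEdge_head] at hc
    rw [this, (monic_of_descent htop hq _).natDegree_mul (monic_X_sub_C _), ih, hc,
      natDegree_X_sub_C]

end Basic

end SplittingAlgebra

/-! ### Descent systems: vertex elements, lifts to vectors, and the shift operator. -/

section

open Polynomial RankedPoset

/-- A family of polynomials indexed by the vertices of a ranked poset with a largest element
which along every edge `e` get multiplied by a linear factor `t - e`. -/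
structure DescentSystem (P : Type*) [PartialOrder P] [OrderTop P] (A : Type*) [Ring A] where
  edge : HasseEdge P → A
  poly : P → A[X]
  poly_top : poly ⊤ = 1
  poly_head : ∀ e, poly e.head = poly e.tail * (X - C (edge e))

/-- The vector of the `i`-th coefficients of a vector of polynomials. -/
def coeffVec {P A : Type*} [Ring A] (i : ℕ) (Y : P → A[X]) : P → A := fun w => (Y w).coeff i

section coeffVec

variable {P A : Type*} [Ring A] (i : ℕ) (Y Z : P → A[X])

@[simp] theorem coeffVec_apply (w : P) : coeffVec i Y w = (Y w).coeff i := rfl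

@[simp] theorem coeffVec_add : coeffVec i (Y + Z) = coeffVec i Y + coeffVec i Z := by
  ext; simp

@[simp] theorem coeffVec_sub : coeffVec i (Y - Z) = coeffVec i Y - coeffVec i Z := by
  ext; simp

@[simp] theorem coeffVec_zero : coeffVec i (0 : P → A[X]) = 0 := by
  ext; simp

theorem coeffVec_smul_C (q : A[X]) (y : P → A) :
    coeffVec i (q • fun w => C (y w)) = q.coeff i • y := by
  ext; simp

@[simp] theorem coeffVec_X_smul_succ :
    coeffVec (i + 1) ((X : A[X]) • Y) = coeffVec i Y := by
  ext; simp

@[simp] theorem coeffVec_X_smul_zero : coeffVec 0 ((X : A[X]) • Y) = 0 := by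
  ext; simp

variable {i Y}

theorem coeffVec_X_smul_mem {K : Submodule A (P → A)} (h : ∀ j, coeffVec j Y ∈ K) (i : ℕ) :
    coeffVec i ((X : A[X]) • Y) ∈ K := by
  cases i with
  | zero => simp
  | succ i => simpa using h i

end coeffVec

namespace DescentSystem

/-- The central variable is moved to the left, where it can act as a scalar on vectors of
polynomials. -/
theorem poly_head' {P : Type*} [PartialOrder P] [OrderTop P] {A : Type*} [Ring A]
    (S : DescentSystem P A) (e : HasseEdge P) :
    S.poly e.head = X * S.poly e.tail - S.poly e.tail * C (S.edge e) := by
  rw [S.poly_head, mul_sub, X_mul]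

section Vertex

variable {P : Type*} [PartialOrder P] [OrderTop P] [RankedPoset P]
  {A : Type*} [Ring A] (S : DescentSystem P A)

/-- The subleading coefficient of the polynomial of `v`. -/
noncomputable def vertex (v : P) : A := (X * S.poly v).coeff (corank v)

-- The factor `X` in `vertex` avoids the index `corank v - 1`, which would truncate at ⊤ and return
-- the leading coefficient 1.
@[simp] theorem vertex_top : S.vertex ⊤ = 0 := by
  simp [vertex]

variable [Finite P]

theorem poly_monic (v : P) : (S.poly v).Monic :=
  SplittingAlgebra.monic_of_descent S.poly_top S.poly_head v

theorem poly_natDegree [Nontrivial A] (v : P) : (S.poly v).natDegree = corank v :=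
  SplittingAlgebra.natDegree_of_descent S.poly_top S.poly_head v

@[simp] theorem poly_coeff_corank (v : P) : (S.poly v).coeff (corank v) = 1 := by
  cases subsingleton_or_nontrivial A
  · exact Subsingleton.elim _ _
  · rw [← S.poly_natDegree v]
    exact S.poly_monic v

/-- Compare the subleading coefficients in P_head = P_tail (t - e). -/
theorem edge_eq (e : HasseEdge P) : S.edge e = S.vertex e.tail - S.vertex e.head := by
  have h : S.vertex e.head = S.vertex e.tail - S.edge e := by
    rw [vertex, poly_head', corank_edge, coeff_X_mul, coeff_sub, coeff_mul_C, poly_coeff_corank,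
      one_mul, vertex]
  rw [h, sub_sub_cancel]

end Vertex

section UnitVec

/-- The unit vector of a vertex other than the largest element. -/
def unitVec {P : Type*} [PartialOrder P] [OrderTop P] [DecidableEq P] (R : Type*) [Ring R]
    (v : P) : P → R := if v = ⊤ then 0 else Pi.single v 1

variable {P : Type*} [PartialOrder P] [OrderTop P] [DecidableEq P] {A : Type*} [Ring A]

theorem C_unitVec (v : P) : (fun w => C (unitVec A v w)) = unitVec A[X] v := by
  unfold unitVec
  split_ifs
  · ext; simp
  · ext w : 1
    by_cases h : w = v
    · subst h; simp
    · simp [h]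

-- As x_⊤ = 0, a zero unit vector at ⊤ lets the formulas for an edge hold unchanged when its tail is
-- ⊤.
@[simp] theorem unitVec_top (R : Type*) [Ring R] : unitVec R (⊤ : P) = 0 := if_pos rfl

theorem coeffVec_smul_unitVec (q : A[X]) (v : P) (i : ℕ) :
    coeffVec i (q • unitVec A[X] v) = q.coeff i • unitVec A v := by
  rw [← C_unitVec, coeffVec_smul_C]

end UnitVec

section Lift

variable {P : Type*} [PartialOrder P] [OrderTop P] [RankedPoset P] [Fintype P] [DecidableEq P]
  {A : Type*} [Ring A] (S : DescentSystem P A)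

/-- Auxiliary recursion for `lift`. -/
noncomputable def liftAux : ℕ → P → P → A[X]
  | 0, _ => 0
  | k + 1, v => if hv : v = ⊤ then 0 else
      -- This copies P_v = t P_u - P_u (x_u - x_v), with unit vectors in place of the vertex
      -- elements and u the chosen cover of v.
      (X : A[X]) • liftAux k (upperEdge v hv).tail -
        S.poly (upperEdge v hv).tail • (unitVec A[X] (upperEdge v hv).tail - unitVec A[X] v)

/-- A vector of polynomials which `eval` maps to the polynomial of `v` without its leading term. -/
noncomputable def lift (v : P) : P → A[X] := S.liftAux (corank v) v

@[simp] theorem lift_top : S.lift ⊤ = 0 := by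
  simp [lift, liftAux]

theorem lift_of_ne_top {v : P} (hv : v ≠ ⊤) : S.lift v =
    (X : A[X]) • S.lift (upperEdge v hv).tail -
        S.poly (upperEdge v hv).tail • (unitVec A[X] (upperEdge v hv).tail - unitVec A[X] v) := by
  have h := corank_edge (upperEdge v hv)
  rw [upperEdge_head] at h
  rw [lift, h, liftAux, dif_neg hv, lift]

/-- The left linear map sending the unit vector of `v` to the vertex element of `v`. -/
noncomputable def eval : (P → A) →ₗ[A] A := Fintype.linearCombination A S.vertex

/-- The extension of `eval` to vectors of polynomials. -/
noncomputable def evalPoly : (P → A[X]) →ₗ[A[X]] A[X] :=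
  Fintype.linearCombination A[X] fun w => C (S.vertex w)

theorem eval_coeffVec (i : ℕ) (Y : P → A[X]) :
    S.eval (coeffVec i Y) = (S.evalPoly Y).coeff i := by
  simp [eval, evalPoly, Fintype.linearCombination_apply]

@[simp] theorem eval_unitVec (v : P) : S.eval (unitVec A v) = S.vertex v := by
  unfold unitVec
  split_ifs with h
  · simp [h]
  · simp [eval]

@[simp] theorem evalPoly_unitVec (v : P) : S.evalPoly (unitVec A[X] v) = C (S.vertex v) := by
  unfold unitVec
  split_ifs with h
  · simp [h]
  · simp [evalPoly]

theorem evalPoly_lift (v : P) : S.evalPoly (S.lift v) = S.poly v - X ^ corank v := by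
  induction v using upperEdge_induction with
  | top => simp [S.poly_top]
  | step v hv ih =>
    have h1 := S.poly_head' (upperEdge v hv)
    have h2 := corank_edge (upperEdge v hv)
    have h3 := S.edge_eq (upperEdge v hv)
    rw [upperEdge_head] at h1 h2 h3
    rw [S.lift_of_ne_top hv, map_sub, map_smul, map_smul, map_sub, ih, evalPoly_unitVec,
      evalPoly_unitVec, h1, h2, h3, pow_succ', ← C_sub]
    simp only [smul_eq_mul]
    noncomm_ring

/-- The images of the unit vectors under `shift`. -/
noncomputable def shiftVec (w : P) : P → A :=
  -- The value is forced by the wanted identity `shiftPoly (lift w) = P_w • unitVec w - X • lift w`: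
  -- its coefficient at `corank w - 1`, where `lift w` has the coefficient `unitVec w`. The square
  -- of `X` again avoids subtracting from the index.
  S.vertex w • unitVec A w - coeffVec (corank w) ((X : A[X]) ^ 2 • S.lift w)

/-- A left linear endomorphism, compatible with the right multiplication by a vertex element
on the ideal of its upper covers. -/
noncomputable def shift : (P → A) →ₗ[A] (P → A) := Fintype.linearCombination A S.shiftVec

/-- The extension of `shift` to vectors of polynomials. -/
noncomputable def shiftPoly : (P → A[X]) →ₗ[A[X]] (P → A[X]) :=
  Fintype.linearCombination A[X] fun w w' => C (S.shiftVec w w')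

theorem shift_coeffVec (i : ℕ) (Y : P → A[X]) :
    S.shift (coeffVec i Y) = coeffVec i (S.shiftPoly Y) := by
  ext w
  simp [shift, shiftPoly, Fintype.linearCombination_apply]

@[simp] theorem shiftVec_top : S.shiftVec ⊤ = 0 := by
  simp [shiftVec]

@[simp] theorem shiftPoly_unitVec (v : P) :
    S.shiftPoly (unitVec A[X] v) = fun w => C (S.shiftVec v w) := by
  unfold unitVec
  split_ifs with h
  · ext; simp [h]
  · simp [shiftPoly]

/-- The relation between the unit vectors given by an edge. -/
noncomputable def relVec (e : HasseEdge P) : P → A[X] :=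
  S.lift e.head - (X : A[X]) • S.lift e.tail +
    S.poly e.tail • (unitVec A[X] e.tail - unitVec A[X] e.head)

@[simp] theorem relVec_upperEdge {v : P} (hv : v ≠ ⊤) : S.relVec (upperEdge v hv) = 0 := by
  rw [relVec, upperEdge_head, S.lift_of_ne_top hv]
  abel

/-- On a chosen edge the last term vanishes. For the other edges the defect consists of a relation,
so it is harmless modulo `relSpan`. -/
theorem shiftVec_tail_sub_head (e : HasseEdge P) : S.shiftVec e.tail - S.shiftVec e.head =
    S.edge e • unitVec A e.head + coeffVec (corank e.head) ((X : A[X]) ^ 2 • S.relVec e) := by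
  have h : S.lift e.head = S.relVec e + (X : A[X]) • S.lift e.tail -
    S.poly e.tail • (unitVec A[X] e.tail - unitVec A[X] e.head) := by
    rw [relVec]; abel
  have h2 : coeffVec (corank e.head) ((X : A[X]) ^ 2 • S.lift e.head) =
      coeffVec (corank e.head) ((X : A[X]) ^ 2 • S.relVec e) +
        coeffVec (corank e.tail) ((X : A[X]) ^ 2 • S.lift e.tail) -
        S.vertex e.tail • (unitVec A e.tail - unitVec A e.head) := by
    rw [h, smul_sub, smul_add, coeffVec_sub, coeffVec_add]
    congr 1
    · congr 1
      rw [smul_smul, ← pow_succ, pow_succ', ← smul_smul, corank_edge, coeffVec_X_smul_succ]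
    · rw [pow_two, mul_smul, corank_edge, coeffVec_X_smul_succ, smul_smul, smul_sub, coeffVec_sub,
        coeffVec_smul_unitVec, coeffVec_smul_unitVec, ← smul_sub, vertex]
  rw [shiftVec, shiftVec, h2, S.edge_eq]
  rw [sub_smul, smul_sub]
  abel

/-- The right side refers only to the vertex, not to anything below it. Hence a single operator
lifts right multiplication by x_v on J_v for all v: if u and u' cover v, then (P_u - P_u') x_v = P_u
x_u - P_u' x_u' - t (P_u - P_u'). -/
theorem shiftPoly_lift (v : P) :
    S.shiftPoly (S.lift v) = S.poly v • unitVec A[X] v - (X : A[X]) • S.lift v := by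
  induction v using upperEdge_induction with
  | top => simp
  | step v hv ih =>
    have h1 := S.poly_head' (upperEdge v hv)
    have h2 := S.shiftVec_tail_sub_head (upperEdge v hv)
    rw [upperEdge_head] at h1 h2
    have h3 : S.shiftPoly (unitVec A[X] (upperEdge v hv).tail) - S.shiftPoly (unitVec A[X] v) =
        C (S.edge (upperEdge v hv)) • unitVec A[X] v := by
      rw [shiftPoly_unitVec, shiftPoly_unitVec]
      rw [relVec_upperEdge, smul_zero, coeffVec_zero, add_zero] at h2
      ext w : 1
      have := congrFun h2 w
      simp only [Pi.sub_apply, Pi.smul_apply, smul_eq_mul] at this ⊢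
      rw [← C_sub, this, C_mul, ← C_unitVec]
    rw [S.lift_of_ne_top hv, map_sub, map_smul, map_smul, map_sub, ih, h3, h1]
    ext w : 1
    simp only [Pi.sub_apply, Pi.smul_apply, smul_eq_mul]
    noncomm_ring

/-- All coefficients on the right are left combinations of coefficients of `relVec e`; this makes
the span of the relations stable under `shift`. -/
theorem shiftPoly_relVec (e : HasseEdge P) : S.shiftPoly (S.relVec e) =
    S.poly e.tail • (fun w => C (coeffVec (corank e.head) ((X : A[X]) ^ 2 • S.relVec e) w)) -
      (X : A[X]) • S.relVec e := by
  have h1 := S.poly_head' e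
  have h3 : S.shiftPoly (unitVec A[X] e.tail) - S.shiftPoly (unitVec A[X] e.head) =
      C (S.edge e) • unitVec A[X] e.head +
        fun w => C (coeffVec (corank e.head) ((X : A[X]) ^ 2 • S.relVec e) w) := by
    rw [shiftPoly_unitVec, shiftPoly_unitVec]
    ext w : 1
    have := congrFun (S.shiftVec_tail_sub_head e) w
    simp only [Pi.sub_apply, Pi.smul_apply, Pi.add_apply, smul_eq_mul] at this ⊢
    rw [← C_sub, this, C_add, C_mul, ← C_unitVec]
  generalize (fun w => C (coeffVec (corank e.head) ((X : A[X]) ^ 2 • S.relVec e) w)) = r at h3 ⊢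
  rw [relVec, map_add, map_sub, map_smul, map_smul, map_sub, shiftPoly_lift, shiftPoly_lift, h3, h1]
  ext w : 1
  simp only [Pi.sub_apply, Pi.smul_apply, Pi.add_apply, smul_eq_mul]
  noncomm_ring

/-- The relation of the vertex `v` attached to a vector `z`. -/
noncomputable def rel (v : P) : (P → A) →ₗ[A] (P → A) :=
  S.eval.smulRight (unitVec A v) - S.shift

theorem rel_apply (v : P) (z : P → A) : S.rel v z = S.eval z • unitVec A v - S.shift z := rfl

/-- Two descriptions of the relations meet here: defects of edges, and `rel v` on differences of
lifts. The powers of `X` in `evalPoly_lift` cancel because the two tails have equal corank. -/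
theorem relVec_sub {v : P} {e e' : HasseEdge P} (h : e.head = v) (h' : e'.head = v) (i : ℕ) :
    coeffVec i (S.relVec e' - S.relVec e) =
      S.rel v (coeffVec i (S.lift e.tail - S.lift e'.tail)) := by
  have hc : corank e.tail = corank e'.tail := by
    have := corank_edge e
    have := corank_edge e'
    rw [h] at *; rw [h'] at *
    omega
  rw [rel_apply, eval_coeffVec, shift_coeffVec, map_sub, map_sub, evalPoly_lift, evalPoly_lift,
    shiftPoly_lift, shiftPoly_lift, hc, sub_sub_sub_cancel_right, ← coeffVec_smul_unitVec,
    ← coeffVec_sub, relVec, relVec, h, h']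
  congr 1
  ext w : 1
  simp only [Pi.sub_apply, Pi.smul_apply, Pi.add_apply, smul_eq_mul]
  noncomm_ring

/-! ### Cover ideals and the span of the relations. -/

/-- The span of the coefficients of the differences of the lifts of the upper covers of `v`. -/
def coverSpan (v : P) : Submodule A (P → A) :=
  Submodule.span A {y | ∃ e e' : HasseEdge P, e.head = v ∧ e'.head = v ∧
    ∃ i, y = coeffVec i (S.lift e.tail - S.lift e'.tail)}

/-- The left ideal generated by the coefficients of the differences of the polynomials of the upper
covers of `v`. -/
noncomputable def coverIdeal (v : P) : Submodule A A := (S.coverSpan v).map S.eval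

theorem eval_coeffVec_lift_sub {v : P} {e e' : HasseEdge P} (h : e.head = v) (h' : e'.head = v)
    (i : ℕ) : S.eval (coeffVec i (S.lift e.tail - S.lift e'.tail)) =
      (S.poly e.tail - S.poly e'.tail).coeff i := by
  have hc : corank e.tail = corank e'.tail := by
    have := corank_edge e
    have := corank_edge e'
    rw [h] at *; rw [h'] at *
    omega
  rw [eval_coeffVec, map_sub, evalPoly_lift, evalPoly_lift, hc, sub_sub_sub_cancel_right]

theorem coverIdeal_eq_span (v : P) : S.coverIdeal v =
    Submodule.span A {d | ∃ e e' : HasseEdge P, e.head = v ∧ e'.head = v ∧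
      ∃ i, d = (S.poly e.tail - S.poly e'.tail).coeff i} := by
  rw [coverIdeal, coverSpan, Submodule.map_span]
  congr 1
  ext d
  constructor
  · rintro ⟨_, ⟨e, e', h, h', i, rfl⟩, rfl⟩
    exact ⟨e, e', h, h', i, S.eval_coeffVec_lift_sub h h' i⟩
  · rintro ⟨e, e', h, h', i, rfl⟩
    exact ⟨_, ⟨e, e', h, h', i, rfl⟩, S.eval_coeffVec_lift_sub h h' i⟩

/-- The span of the relations of the vertices of corank at most `k`. -/
noncomputable def relSpan (k : ℕ) : Submodule A (P → A) :=
  ⨆ v : P, ⨆ _ : corank v ≤ k, (S.coverSpan v).map (S.rel v)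

theorem relSpan_mono {k l : ℕ} (h : k ≤ l) : S.relSpan k ≤ S.relSpan l :=
  iSup_mono fun _ => iSup_mono' fun hv => ⟨hv.trans h, le_rfl⟩

theorem rel_mem_relSpan {v : P} {k : ℕ} (hv : corank v ≤ k) {z : P → A}
    (hz : z ∈ S.coverSpan v) : S.rel v z ∈ S.relSpan k :=
  (le_iSup₂_of_le (f := fun (v : P) (_ : corank v ≤ k) => (S.coverSpan v).map (S.rel v)) v hv
    le_rfl) (Submodule.mem_map_of_mem hz)

/-- Compare `e` with the chosen edge of the same head, whose `relVec` is zero. -/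
theorem coeffVec_relVec_mem {e : HasseEdge P} {k : ℕ} (h : corank e.head ≤ k) (i : ℕ) :
    coeffVec i (S.relVec e) ∈ S.relSpan k := by
  have h1 := S.relVec_sub (v := e.head) (e := upperEdge e.head (edge_head_ne_top e)) (e' := e)
    rfl rfl i
  rw [relVec_upperEdge, sub_zero] at h1
  rw [h1]
  exact S.rel_mem_relSpan h (Submodule.subset_span
    ⟨upperEdge e.head (edge_head_ne_top e), e, rfl, rfl, i, rfl⟩)

/-- Modulo the relations the recursion defining `lift` holds along every edge, not only along the
chosen ones. -/
theorem mkQ_coeffVec_lift_head {e : HasseEdge P} {k : ℕ} (h : corank e.head ≤ k) (i : ℕ) :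
    (S.relSpan k).mkQ (coeffVec i (S.lift e.head)) =
      (S.relSpan k).mkQ (coeffVec i ((X : A[X]) • S.lift e.tail)) -
      (S.poly e.tail).coeff i • (S.relSpan k).mkQ (unitVec _ e.tail - unitVec _ e.head) := by
  rw [← map_smul, ← map_sub, ← sub_eq_zero, ← map_sub, ← LinearMap.mem_ker, Submodule.ker_mkQ]
  have h1 := S.coeffVec_relVec_mem h i
  rwa [relVec, coeffVec_add, coeffVec_sub, smul_sub, coeffVec_sub, coeffVec_smul_unitVec,
    coeffVec_smul_unitVec, ← smul_sub, sub_add] at h1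

/-- With `coeffVec_relVec_mem` this identifies `relSpan k` with the span of the coefficients of the
`relVec e`, so inclusions can be tested on edges. -/
theorem relSpan_le {k : ℕ} {N : Submodule A (P → A)}
    (h : ∀ e : HasseEdge P, corank e.head ≤ k → ∀ i, coeffVec i (S.relVec e) ∈ N) :
    S.relSpan k ≤ N := by
  refine iSup₂_le fun v hv => ?_
  rw [Submodule.map_le_iff_le_comap, coverSpan, Submodule.span_le]
  rintro _ ⟨e, e', he, he', i, rfl⟩
  rw [SetLike.mem_coe, Submodule.mem_comap, ← S.relVec_sub he he', coeffVec_sub]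
  exact N.sub_mem (h _ (by rwa [he']) i) (h _ (by rwa [he]) i)

theorem shift_mem_relSpan {k : ℕ} {y : P → A} (hy : y ∈ S.relSpan k) :
    S.shift y ∈ S.relSpan k := by
  suffices h : S.relSpan k ≤ (S.relSpan k).comap S.shift from h hy
  refine S.relSpan_le fun e he i => ?_
  have h := fun j => S.coeffVec_relVec_mem he j
  rw [Submodule.mem_comap, shift_coeffVec, shiftPoly_relVec, coeffVec_sub, coeffVec_smul_C]
  refine Submodule.sub_mem _ (Submodule.smul_mem _ _ ?_) (coeffVec_X_smul_mem h i)
  rw [pow_two, mul_smul]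
  exact coeffVec_X_smul_mem (coeffVec_X_smul_mem h) _

theorem evalPoly_relVec (e : HasseEdge P) : S.evalPoly (S.relVec e) = 0 := by
  rw [relVec, map_add, map_sub, map_smul, map_smul, map_sub, evalPoly_lift, evalPoly_lift,
    evalPoly_unitVec, evalPoly_unitVec, S.poly_head' e, corank_edge, S.edge_eq, pow_succ', ← C_sub]
  simp only [smul_eq_mul]
  noncomm_ring

theorem eval_eq_zero_of_mem_relSpan {k : ℕ} {y : P → A} (hy : y ∈ S.relSpan k) :
    S.eval y = 0 := by
  rw [← LinearMap.mem_ker]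
  revert y
  change S.relSpan k ≤ LinearMap.ker S.eval
  refine S.relSpan_le fun e _ i => ?_
  rw [LinearMap.mem_ker, eval_coeffVec, evalPoly_relVec, coeff_zero]

/-- This is the vanishing of `eval (rel v z)`; `shift` does not depend on `v`, which allows sums
over several vertices later. -/
theorem eval_shift_eq {v : P} {z : P → A} (hz : z ∈ S.coverSpan v) :
    S.eval (S.shift z) = S.eval z * S.vertex v := by
  have h := S.eval_eq_zero_of_mem_relSpan (S.rel_mem_relSpan le_rfl hz)
  rw [rel_apply, map_sub, map_smul, eval_unitVec, sub_eq_zero, smul_eq_mul] at h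
  exact h.symm

/-! ### The filtration of vectors by the corank of their support. -/

variable (A) in
/-- The vectors supported on the vertices of positive corank at most `k`. -/
def vanishing (P : Type*) [PartialOrder P] [OrderTop P] [RankedPoset P] (k : ℕ) :
    Submodule A (P → A) where
  carrier := {y | ∀ w, w = ⊤ ∨ k < corank w → y w = 0}
  zero_mem' := fun _ _ => rfl
  add_mem' := fun {a b} ha hb w hw => by simp [ha w hw, hb w hw]
  smul_mem' := fun c a ha w hw => by simp [ha w hw]

theorem vanishing_mono {k l : ℕ} (h : k ≤ l) : vanishing A P k ≤ vanishing A P l :=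
  fun _ hy w hw => hy w (hw.imp_right h.trans_lt)

theorem unitVec_mem_vanishing {v : P} {k : ℕ} (h : corank v ≤ k) :
    unitVec A v ∈ vanishing A P k := by
  intro w hw
  unfold unitVec
  split_ifs with hv
  · rfl
  · refine Pi.single_eq_of_ne ?_ _
    rintro rfl
    rcases hw with hw | hw
    · exact hv hw
    · omega

theorem coeffVec_lift_mem_vanishing (v : P) (i : ℕ) :
    coeffVec i (S.lift v) ∈ vanishing A P (corank v) := by
  induction v using upperEdge_induction generalizing i with
  | top => simp
  | step v hv ih =>
    have h := corank_edge (upperEdge v hv)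
    rw [upperEdge_head] at h
    rw [S.lift_of_ne_top hv, coeffVec_sub]
    refine Submodule.sub_mem _ (coeffVec_X_smul_mem (fun j => vanishing_mono (by omega) (ih j)) i) ?_
    rw [smul_sub, coeffVec_sub, coeffVec_smul_unitVec, coeffVec_smul_unitVec]
    exact Submodule.sub_mem _ (Submodule.smul_mem _ _ (unitVec_mem_vanishing (by omega)))
      (Submodule.smul_mem _ _ (unitVec_mem_vanishing le_rfl))

theorem shiftVec_mem_vanishing (v : P) : S.shiftVec v ∈ vanishing A P (corank v) := by
  refine Submodule.sub_mem _ (Submodule.smul_mem _ _ (unitVec_mem_vanishing le_rfl)) ?_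
  rw [pow_two, mul_smul]
  exact coeffVec_X_smul_mem (coeffVec_X_smul_mem (S.coeffVec_lift_mem_vanishing v)) _

theorem shift_mem_vanishing {k : ℕ} {y : P → A} (hy : y ∈ vanishing A P k) :
    S.shift y ∈ vanishing A P k := by
  rw [shift, Fintype.linearCombination_apply]
  refine Submodule.sum_mem _ fun w _ => ?_
  by_cases hw : corank w ≤ k
  · exact Submodule.smul_mem _ _ (vanishing_mono hw (S.shiftVec_mem_vanishing w))
  · rw [hy w (Or.inr (by omega)), zero_smul]
    exact Submodule.zero_mem _

theorem coverSpan_le_vanishing {v : P} {k : ℕ} (h : corank v = k + 1) :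
    S.coverSpan v ≤ vanishing A P k := by
  rw [coverSpan, Submodule.span_le]
  rintro _ ⟨e, e', he, he', i, rfl⟩
  have h1 := corank_edge e
  have h2 := corank_edge e'
  rw [he] at h1
  rw [he'] at h2
  rw [coeffVec_sub]
  exact Submodule.sub_mem _ (vanishing_mono (by omega) (S.coeffVec_lift_mem_vanishing _ i))
    (vanishing_mono (by omega) (S.coeffVec_lift_mem_vanishing _ i))

theorem coverSpan_top : S.coverSpan ⊤ = ⊥ := by
  rw [coverSpan, Submodule.span_eq_bot]
  rintro _ ⟨e, _, he, _⟩
  exact absurd he (edge_head_ne_top e)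

theorem relSpan_zero : S.relSpan 0 = ⊥ := by
  rw [relSpan]
  refine iSup₂_eq_bot.2 fun v hv => ?_
  obtain rfl := corank_eq_zero_iff.1 (Nat.le_zero.1 hv)
  rw [coverSpan_top, Submodule.map_bot]

/-- Since `shift` does not enlarge the corank of the support, `rel v z` has leading term `eval z` at
`v`. -/
theorem rel_apply_of_mem {v w : P} {k : ℕ} {z : P → A} (hz : z ∈ vanishing A P k)
    (hw : k < corank w) : S.rel v z w = S.eval z * unitVec A v w := by
  rw [rel_apply, Pi.sub_apply, S.shift_mem_vanishing hz w (Or.inr hw), sub_zero]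
  rfl

theorem relSpan_le_vanishing (k : ℕ) : S.relSpan k ≤ vanishing A P k := by
  refine iSup₂_le fun v hv => ?_
  rintro _ ⟨z, hz, rfl⟩
  rcases Nat.eq_zero_or_pos (corank v) with h | h
  · obtain rfl := corank_eq_zero_iff.1 h
    rw [coverSpan_top] at hz
    rw [(Submodule.mem_bot A).1 hz, map_zero]
    exact Submodule.zero_mem _
  · have hz' := S.coverSpan_le_vanishing (k := corank v - 1) (by omega) hz
    exact Submodule.sub_mem _ (Submodule.smul_mem _ _ (unitVec_mem_vanishing hv))
      (S.shift_mem_vanishing (vanishing_mono (by omega) hz'))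

/-- Among the relations of vertices of corank at most that of `v`, only those of `v` itself have a
nonzero coordinate at `v`, and it lies in J_v. -/
theorem apply_mem_coverIdeal {v : P} {y : P → A} (hy : y ∈ S.relSpan (corank v)) :
    y v ∈ S.coverIdeal v := by
  revert y
  change S.relSpan (corank v) ≤ (S.coverIdeal v).comap (LinearMap.proj v)
  refine iSup₂_le fun w hw => ?_
  rintro _ ⟨z, hz, rfl⟩
  rw [Submodule.mem_comap, LinearMap.proj_apply]
  rcases Nat.eq_zero_or_pos (corank w) with h | h
  · obtain rfl := corank_eq_zero_iff.1 h
    rw [coverSpan_top] at hz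
    rw [(Submodule.mem_bot A).1 hz, map_zero]
    exact Submodule.zero_mem _
  · have hz' := S.coverSpan_le_vanishing (k := corank w - 1) (by omega) hz
    rw [S.rel_apply_of_mem hz' (by omega)]
    by_cases hvw : w = v
    · subst hvw
      have hw0 : w ≠ ⊤ := by
        rintro rfl
        simp at h
      rw [unitVec, if_neg hw0, Pi.single_eq_same, mul_one]
      exact Submodule.mem_map_of_mem hz
    · have : unitVec A w v = 0 := by
        unfold unitVec
        split_ifs
        · rfl
        · exact Pi.single_eq_of_ne (Ne.symm hvw) _
      rw [this, mul_zero]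
      exact Submodule.zero_mem _

theorem exists_eq_add_sum_of_mem_relSpan_succ {k : ℕ} {y : P → A} (hy : y ∈ S.relSpan (k + 1)) :
    ∃ y' ∈ S.relSpan k, ∃ z : P → P → A, (∀ v, z v ∈ S.coverSpan v) ∧
      y = y' + ∑ v with corank v = k + 1, S.rel v (z v) := by
  have h : S.relSpan (k + 1) ≤ S.relSpan k ⊔
      ⨆ v ∈ Finset.univ.filter (fun v : P => corank v = k + 1), (S.coverSpan v).map (S.rel v) := by
    refine iSup₂_le fun v hv => ?_
    rcases Nat.lt_or_ge k (corank v) with h | h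
    · exact le_sup_of_le_right (le_iSup₂_of_le v (by simp; omega) le_rfl)
    · exact le_sup_of_le_left
        (le_iSup₂_of_le (f := fun (v : P) (_ : corank v ≤ k) => (S.coverSpan v).map (S.rel v)) v h
          le_rfl)
  obtain ⟨y', hy', y'', hy'', rfl⟩ := Submodule.mem_sup.1 (h hy)
  obtain ⟨μ, rfl⟩ := (Submodule.mem_iSup_finset_iff_exists_sum _ _).1 hy''
  choose z hz hz' using fun v => (μ v).2
  exact ⟨y', hy', z, hz, by simp [hz']⟩

end Lift

end DescentSystem

end

/-! ### Completeness of the relations, via triangular matrices. -/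

section

open Polynomial RankedPoset

section Triangular

variable (F : Type*) [Field F] {A : Type*} [Ring A] [Algebra F A] {N : Type*} [AddCommGroup N]
  [Module A N] [Module F N] [IsScalarTower F A N]

/-- The endomorphism of `N × F` given by the triangular matrix with diagonal entries `a` and `c` and
off-diagonal entry `n`. -/
def triangularEnd (a : A) (n : N) (c : F) : Module.End F (N × F) where
  toFun m := (a • m.1 + m.2 • n, c * m.2)
  map_add' m m' := by
    ext <;> simp [add_smul, mul_add]
    abel
  map_smul' d m := by
    ext
    · change a • d • m.1 + (d * m.2) • n = d • (a • m.1 + m.2 • n)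
      rw [smul_add, smul_smul, smul_algebra_smul_comm]
    · simp [mul_left_comm]

@[simp] theorem triangularEnd_apply (a : A) (n : N) (c : F) (m : N × F) :
    triangularEnd F a n c m = (a • m.1 + m.2 • n, c * m.2) := rfl

/-- The off-diagonal entry obeys D(ab) = a D(b) + ε(b) D(a), so a representation of this shape is a
derivation twisted by the augmentation ε. -/
theorem triangularEnd_mul (a a' : A) (n n' : N) (c c' : F) :
    triangularEnd F a n c * triangularEnd F a' n' c' =
      triangularEnd F (a * a') (a • n' + c' • n) (c * c') := by
  refine LinearMap.ext fun m => ?_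
  ext
  · change a • (a' • m.1 + m.2 • n') + (c' * m.2) • n = (a * a') • m.1 + m.2 • (a • n' + c' • n)
    rw [smul_add, smul_add, mul_smul a, mul_smul c', smul_algebra_smul_comm m.2 a,
      smul_comm m.2 c', add_assoc]
  · simp [mul_assoc]

theorem triangularEnd_mul_zero (a a' : A) (n n' : N) (c : F) :
    triangularEnd F a n c * triangularEnd F a' n' 0 = triangularEnd F (a * a') (a • n') 0 := by
  rw [triangularEnd_mul, zero_smul, add_zero, mul_zero]

theorem triangularEnd_sub (a a' : A) (n n' : N) (c c' : F) :
    triangularEnd F a n c - triangularEnd F a' n' c' =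
      triangularEnd F (a - a') (n - n') (c - c') := by
  refine LinearMap.ext fun m => ?_
  ext
  · simp [sub_smul, smul_sub]
    abel
  · simp [sub_mul]

theorem triangularEnd_add (a a' : A) (n n' : N) (c c' : F) :
    triangularEnd F a n c + triangularEnd F a' n' c' =
      triangularEnd F (a + a') (n + n') (c + c') := by
  refine LinearMap.ext fun m => ?_
  ext
  · simp [add_smul, smul_add]
    abel
  · simp [add_mul]

theorem triangularEnd_zero : triangularEnd F (0 : A) (0 : N) 0 = 0 := by
  refine LinearMap.ext fun m => ?_
  ext <;> simp

theorem triangularEnd_algebraMap (c : F) :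
    triangularEnd F (algebraMap F A c) (0 : N) c = algebraMap F (Module.End F (N × F)) c := by
  refine LinearMap.ext fun m => ?_
  ext <;> simp

end Triangular

theorem Polynomial.exists_coeff_eq {R : Type*} [Semiring R] (f : ℕ → R) (B : ℕ)
    (h : ∀ i, B < i → f i = 0) : ∃ p : R[X], ∀ i, p.coeff i = f i := by
  refine ⟨∑ i ∈ Finset.range (B + 1), monomial i (f i), fun i => ?_⟩
  simp only [finsetSum_coeff, coeff_monomial]
  rw [Finset.sum_ite_eq']
  split_ifs with hi
  · rfl
  · exact (h i (by simpa using hi)).symm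

theorem Polynomial.eq_mul_X_sub_C_of_coeff {R : Type*} [Ring R] {p q : R[X]} {a : R}
    (h0 : p.coeff 0 = -(q.coeff 0 * a))
    (hs : ∀ i, p.coeff (i + 1) = q.coeff i - q.coeff (i + 1) * a) : p = q * (X - C a) := by
  ext i
  rw [mul_sub, coeff_sub, coeff_mul_C]
  cases i with
  | zero => rw [coeff_mul_X_zero, h0, zero_sub]
  | succ i => rw [coeff_mul_X, hs]

namespace SplittingAlgebra

variable (F : Type*) [Field F] (P : Type*) [PartialOrder P] [OrderTop P] [RankedPoset P] [Fintype P]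

/-- The vertex polynomials of the splitting algebra. -/
noncomputable def descentSystem : DescentSystem P (SplittingAlgebra F P) where
  edge := edge F
  poly := vertexPoly F
  poly_top := vertexPoly_top F
  poly_head := vertexPoly_head F

variable {F P}

theorem induction_on {motive : SplittingAlgebra F P → Prop}
    (algebraMap : ∀ c, motive (algebraMap F _ c)) (edge : ∀ e, motive (edge F e))
    (mul : ∀ a b, motive a → motive b → motive (a * b))
    (add : ∀ a b, motive a → motive b → motive (a + b)) (a : SplittingAlgebra F P) : motive a := by
  obtain ⟨a, rfl⟩ := RingQuot.mkAlgHom_surjective F (SplittingRel F P) a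
  induction a using FreeAlgebra.induction with
  | grade0 c => rw [AlgHom.commutes]; exact algebraMap c
  | grade1 e => exact edge e
  | mul a b ha hb => rw [map_mul]; exact mul _ _ ha hb
  | add a b ha hb => rw [map_add]; exact add _ _ ha hb

variable [DecidableEq P]

open DescentSystem in
/-- The relations between the vertex elements of the splitting algebra are generated by the
relations in `relSpan`. -/
theorem mem_relSpan_of_eval_eq_zero {y : P → SplittingAlgebra F P} (hy : y ⊤ = 0)
    (h : (descentSystem F P).eval y = 0) :
    y ∈ (descentSystem F P).relSpan (RankedPoset.rank (⊤ : P)) := by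
  set S := descentSystem F P with hS
  set K := S.relSpan (RankedPoset.rank (⊤ : P)) with hK
  -- The aim is a twisted derivation D from A to the quotient by `K` that sends x_v to the class of
  -- its unit vector; augmentation 0 on edges.
  let f (e : HasseEdge P) := triangularEnd F (S.edge e)
    (K.mkQ (unitVec _ e.tail - unitVec _ e.head)) 0
  -- The images of the vertex polynomials must have diagonal entries P_v and t^corank v, and `lift
  -- v` off the diagonal.
  have hq (v : P) : ∃ q : (Module.End F (((P → SplittingAlgebra F P) ⧸ K) × F))[X], ∀ i,
      q.coeff i = triangularEnd F ((S.poly v).coeff i) (K.mkQ (coeffVec i (S.lift v)))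
        (if i = corank v then 1 else 0) := by
    refine Polynomial.exists_coeff_eq _
      ((S.poly v).natDegree + ∑ w, (S.lift v w).natDegree + corank v) fun i hi => ?_
    rw [coeff_eq_zero_of_natDegree_lt (by omega), if_neg (by omega)]
    have : coeffVec i (S.lift v) = 0 := by
      ext w : 1
      refine coeff_eq_zero_of_natDegree_lt (lt_of_le_of_lt ?_ hi)
      have := Finset.single_le_sum (f := fun w => (S.lift v w).natDegree) (fun _ _ => Nat.zero_le _)
        (Finset.mem_univ w)
      omega
    rw [this, map_zero, triangularEnd_zero]
  choose q hq using hq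
  -- This is where the quotient by `K` is needed: it gives the descent relation at all edges.
  have hmk (e : HasseEdge P) (i : ℕ) : K.mkQ (coeffVec i (S.lift e.head)) =
      K.mkQ (coeffVec i ((X : (SplittingAlgebra F P)[X]) • S.lift e.tail)) -
      (S.poly e.tail).coeff i • K.mkQ (unitVec _ e.tail - unitVec _ e.head) := 
    S.mkQ_coeffVec_lift_head (Nat.sub_le _ _) i
  have htop : q ⊤ = 1 := by
    ext1 i
    rw [hq, lift_top, coeffVec_zero, map_zero, corank_top, S.poly_top, coeff_one, coeff_one]
    split_ifs with hi
    · simpa using triangularEnd_algebraMap (A := SplittingAlgebra F P)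
        (N := (P → SplittingAlgebra F P) ⧸ K) F 1
    · exact triangularEnd_zero F
  have hhead (e : HasseEdge P) : q e.head = q e.tail * (X - C (f e)) := by
    refine Polynomial.eq_mul_X_sub_C_of_coeff ?_ fun i => ?_
    · rw [hq, hq, triangularEnd_mul_zero, hmk, S.poly_head', coeff_sub, coeff_mul_C, corank_edge,
        ← zero_sub, ← triangularEnd_zero F (A := SplittingAlgebra F P), triangularEnd_sub]
      simp
    · rw [hq, hq, hq, triangularEnd_mul_zero, hmk, S.poly_head', coeff_sub, coeff_mul_C, corank_edge,
        triangularEnd_sub]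
      simp
  obtain ⟨ψ, hψ⟩ := exists_lift F htop hhead
  have hψ1 (a : SplittingAlgebra F P) : ∃ n c, ψ a = triangularEnd F a n c := by
    induction a using induction_on with
    | algebraMap c => exact ⟨0, c, by rw [AlgHom.commutes, triangularEnd_algebraMap]⟩
    | edge e => exact ⟨_, _, hψ e⟩
    | mul a b ha hb =>
      obtain ⟨n, c, h⟩ := ha
      obtain ⟨n', c', h'⟩ := hb
      exact ⟨_, _, by rw [map_mul, h, h', triangularEnd_mul]⟩
    | add a b ha hb =>
      obtain ⟨n, c, h⟩ := ha
      obtain ⟨n', c', h'⟩ := hb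
      exact ⟨_, _, by rw [map_add, h, h', triangularEnd_add]⟩
  have hψ2 (v : P) : ψ (S.vertex v) = triangularEnd F (S.vertex v) (K.mkQ (unitVec _ v)) 0 := by
    induction v using upperEdge_induction with
    | top => simp [triangularEnd_zero]
    | step v hv ih =>
      have h1 := S.edge_eq (upperEdge v hv)
      rw [upperEdge_head] at h1
      have h2 : S.vertex v = S.vertex (upperEdge v hv).tail - S.edge (upperEdge v hv) := by
        rw [h1, sub_sub_cancel]
      have h3 : ψ (S.edge (upperEdge v hv)) = f (upperEdge v hv) := hψ _
      rw [h2, map_sub, ih, h3, triangularEnd_sub]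
      simp
  -- Applying the matrix to (0, 1) reads off D. As x_w has augmentation 0, D(y_w x_w) is y_w times
  -- the class of the unit vector, so `eval y` determines the class of `y`.
  have h1 : (ψ (S.eval y) (0, 1)).1 = K.mkQ y := by
    have h2 : K.mkQ y = ∑ w, y w • K.mkQ (unitVec _ w) := by
      simp only [← map_smul, ← map_sum]
      congr 1
      ext v
      rw [Finset.sum_apply, Finset.sum_eq_single v]
      · by_cases hv : v = ⊤
        · simp [hv, hy]
        · simp [unitVec, hv]
      · intro w _ hw
        by_cases hv : w = ⊤
        · simp [hv]
        · simp [unitVec, hv, hw.symm]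
      · simp
    rw [h2, DescentSystem.eval, Fintype.linearCombination_apply, map_sum, LinearMap.sum_apply, Prod.fst_sum]
    refine Finset.sum_congr rfl fun w _ => ?_
    obtain ⟨n, c, hn⟩ := hψ1 (y w)
    rw [smul_eq_mul, map_mul, hψ2, hn, triangularEnd_mul]
    simp
  rw [h, map_zero] at h1
  exact (Submodule.Quotient.mk_eq_zero K).1 h1.symm

/-- Sending all edges to 0 defines an algebra map to the field. -/
theorem one_ne_zero' : (1 : SplittingAlgebra F P) ≠ 0 := by
  obtain ⟨ψ, -⟩ := exists_lift (P := P) (B := F) F (f := fun _ => 0) (q := fun v => X ^ corank v)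
    (by simp) (fun e => by simp [corank_edge, pow_succ])
  intro h
  simpa using congrArg ψ h

end SplittingAlgebra

end

/-! ### Homogeneity, and relations between vertices of bounded corank. -/

section

open Polynomial RankedPoset

section ProjVec

variable {F A : Type*} [Field F] [Ring A] [Algebra F A] (𝒜 : ℕ → Submodule F A) [GradedAlgebra 𝒜]

open DirectSum in
theorem GradedAlgebra.proj_mul_of_left_mem {i : ℕ} {a : A} (ha : a ∈ 𝒜 i) (b : A) (m : ℕ) :
    GradedAlgebra.proj 𝒜 m (a * b) = if i ≤ m then a * GradedAlgebra.proj 𝒜 (m - i) b else 0 :=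
  coe_decompose_mul_of_left_mem 𝒜 m ha

open DirectSum in
theorem GradedAlgebra.proj_mul_of_right_mem {i : ℕ} {b : A} (a : A) (hb : b ∈ 𝒜 i) (m : ℕ) :
    GradedAlgebra.proj 𝒜 m (a * b) = if i ≤ m then GradedAlgebra.proj 𝒜 (m - i) a * b else 0 :=
  coe_decompose_mul_of_right_mem 𝒜 m hb

theorem GradedAlgebra.proj_mem (m : ℕ) (a : A) : GradedAlgebra.proj 𝒜 m a ∈ 𝒜 m := by
  rw [GradedAlgebra.proj_apply]
  exact Subtype.mem _

theorem GradedAlgebra.proj_of_mem {m : ℕ} {a : A} (ha : a ∈ 𝒜 m) :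
    GradedAlgebra.proj 𝒜 m a = a := by
  rw [GradedAlgebra.proj_apply, DirectSum.decompose_of_mem_same 𝒜 ha]

theorem GradedAlgebra.proj_of_mem_ne {m n : ℕ} {a : A} (ha : a ∈ 𝒜 m) (h : m ≠ n) :
    GradedAlgebra.proj 𝒜 n a = 0 := by
  rw [GradedAlgebra.proj_apply, DirectSum.decompose_of_mem_ne 𝒜 ha h]

/-- The componentwise projection of vectors to a homogeneous component. -/
noncomputable def projVec (P : Type*) (m : ℕ) : (P → A) →ₗ[F] (P → A) :=
  (GradedAlgebra.proj 𝒜 m).compLeft P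

variable {P : Type*}

@[simp] theorem projVec_apply (m : ℕ) (y : P → A) (w : P) :
    projVec 𝒜 P m y w = GradedAlgebra.proj 𝒜 m (y w) := rfl

variable {𝒜}

theorem projVec_of_forall_mem {m : ℕ} {y : P → A} (hy : ∀ w, y w ∈ 𝒜 m) :
    projVec 𝒜 P m y = y :=
  funext fun w => GradedAlgebra.proj_of_mem 𝒜 (hy w)

theorem projVec_smul_of_mem {i : ℕ} {a : A} (ha : a ∈ 𝒜 i) (y : P → A) (m : ℕ) :
    projVec 𝒜 P m (a • y) = if i ≤ m then a • projVec 𝒜 P (m - i) y else 0 := by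
  ext w
  rw [projVec_apply, Pi.smul_apply, smul_eq_mul, GradedAlgebra.proj_mul_of_left_mem 𝒜 ha]
  split_ifs <;> rfl

theorem projVec_mem_span {s : Set (P → A)} (hs : ∀ y ∈ s, ∃ j, ∀ w, y w ∈ 𝒜 j) {y : P → A}
    (hy : y ∈ Submodule.span A s) (m : ℕ) : projVec 𝒜 P m y ∈ Submodule.span A s := by
  induction hy using Submodule.span_induction generalizing m with
  | mem y hy =>
    obtain ⟨j, hj⟩ := hs y hy
    by_cases hjm : j = m
    · subst hjm
      rw [projVec_of_forall_mem hj]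
      exact Submodule.subset_span hy
    · have : projVec 𝒜 P m y = 0 := funext fun w => GradedAlgebra.proj_of_mem_ne 𝒜 (hj w) hjm
      rw [this]
      exact Submodule.zero_mem _
  | zero => rw [map_zero]; exact Submodule.zero_mem _
  | add y z _ _ hy hz => rw [map_add]; exact Submodule.add_mem _ (hy m) (hz m)
  | smul a y _ hy =>
    induction a using DirectSum.Decomposition.inductionOn 𝒜 with
    | zero => rw [zero_smul, map_zero]; exact Submodule.zero_mem _
    | homogeneous a =>
      rw [projVec_smul_of_mem a.2]
      split_ifs
      · exact Submodule.smul_mem _ _ (hy _)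
      · exact Submodule.zero_mem _
    | add a b ha hb => rw [add_smul, map_add]; exact Submodule.add_mem _ ha hb

end ProjVec

namespace DescentSystem

variable {P : Type*} [PartialOrder P] [OrderTop P] [RankedPoset P] [Fintype P]
  {F A : Type*} [Field F] [Ring A] [Algebra F A] {𝒜 : ℕ → Submodule F A} [GradedAlgebra 𝒜]
  {S : DescentSystem P A} (hS : ∀ e, S.edge e ∈ 𝒜 1)

include hS

theorem coeff_poly_mem (v : P) (i : ℕ) :
    (∀ j, i + j = corank v → (S.poly v).coeff i ∈ 𝒜 j) ∧
      (corank v < i → (S.poly v).coeff i = 0) := by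
  induction v using upperEdge_induction generalizing i with
  | top =>
    rw [S.poly_top, corank_top, coeff_one]
    constructor
    · intro j hij
      obtain ⟨rfl, rfl⟩ := Nat.add_eq_zero_iff.1 hij
      simpa using SetLike.GradedOne.one_mem
    · intro hi
      exact if_neg hi.ne'
  | step v hv ih =>
    have h1 := S.poly_head' (upperEdge v hv)
    have h2 := corank_edge (upperEdge v hv)
    rw [upperEdge_head] at h1 h2
    rw [h1, h2, coeff_sub, coeff_mul_C]
    constructor
    · intro j hij
      refine Submodule.sub_mem _ ?_ ?_
      · cases i with
        | zero => rw [coeff_X_mul_zero]; exact Submodule.zero_mem _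
        | succ i => rw [coeff_X_mul]; exact (ih i).1 j (by omega)
      · cases j with
        | zero => rw [(ih i).2 (by omega), zero_mul]; exact Submodule.zero_mem _
        | succ j => exact SetLike.mul_mem_graded ((ih i).1 j (by omega)) (hS _)
    · intro hi
      rw [(ih i).2 (by omega), zero_mul, sub_zero]
      cases i with
      | zero => rw [coeff_X_mul_zero]
      | succ i => rw [coeff_X_mul]; exact (ih i).2 (by omega)

theorem vertex_mem (v : P) : S.vertex v ∈ 𝒜 1 := by
  rw [vertex]
  by_cases hv : v = ⊤
  · subst hv
    simp
  · obtain ⟨k, hk⟩ := Nat.exists_eq_add_of_lt (corank_pos hv)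
    rw [zero_add] at hk
    rw [hk, coeff_X_mul]
    exact (coeff_poly_mem hS v k).1 1 hk.symm

variable [DecidableEq P]

omit hS [RankedPoset P] [Fintype P] in
theorem unitVec_mem (v w : P) : unitVec A v w ∈ 𝒜 0 := by
  unfold unitVec
  split_ifs
  · exact Submodule.zero_mem _
  · by_cases h : w = v
    · subst h
      rw [Pi.single_eq_same]
      exact SetLike.GradedOne.one_mem
    · rw [Pi.single_eq_of_ne h]
      exact Submodule.zero_mem _

/-- The degree is one less than for the coefficients of P_v, since `eval` supplies a further factor
x_w of degree 1. -/
theorem coeff_lift_mem (v : P) (i : ℕ) :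
    (∀ j, i + j + 1 = corank v → ∀ w, (S.lift v w).coeff i ∈ 𝒜 j) ∧
      (corank v ≤ i → coeffVec i (S.lift v) = 0) := by
  induction v using upperEdge_induction generalizing i with
  | top => simp
  | step v hv ih =>
    have h2 := corank_edge (upperEdge v hv)
    rw [upperEdge_head] at h2
    have h1 : coeffVec i (S.lift v) =
      coeffVec i ((X : A[X]) • S.lift (upperEdge v hv).tail) - (S.poly (upperEdge v hv).tail).coeff i •
        (unitVec A (upperEdge v hv).tail - unitVec A v) := by
      rw [S.lift_of_ne_top hv, coeffVec_sub, smul_sub, coeffVec_sub, coeffVec_smul_unitVec,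
        coeffVec_smul_unitVec, smul_sub]
    constructor
    · intro j hij w
      rw [← coeffVec_apply, h1, Pi.sub_apply, Pi.smul_apply, smul_eq_mul]
      refine Submodule.sub_mem _ ?_ ?_
      · cases i with
        | zero => rw [coeffVec_X_smul_zero]; exact Submodule.zero_mem _
        | succ i => rw [coeffVec_X_smul_succ]; exact (ih i).1 j (by omega) w
      · have := SetLike.mul_mem_graded ((coeff_poly_mem hS (upperEdge v hv).tail i).1 j (by omega))
          (Submodule.sub_mem _ (unitVec_mem (𝒜 := 𝒜) (upperEdge v hv).tail w) (unitVec_mem v w))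
        simpa using this
    · intro hi
      rw [h1, (coeff_poly_mem hS _ i).2 (by omega), zero_smul, sub_zero]
      cases i with
      | zero => rw [coeffVec_X_smul_zero]
      | succ i => rw [coeffVec_X_smul_succ]; exact (ih i).2 (by omega)

theorem shiftVec_mem (v w : P) : S.shiftVec v w ∈ 𝒜 1 := by
  rw [shiftVec, Pi.sub_apply, Pi.smul_apply, smul_eq_mul]
  refine Submodule.sub_mem _ ?_ ?_
  · simpa using SetLike.mul_mem_graded (vertex_mem hS v) (unitVec_mem (𝒜 := 𝒜) v w)
  · rw [coeffVec_apply, Pi.smul_apply, smul_eq_mul, coeff_X_pow_mul']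
    split_ifs with h
    · exact (coeff_lift_mem hS v _).1 1 (by omega) w
    · exact Submodule.zero_mem _

theorem projVec_mem_coverSpan {v : P} {z : P → A} (hz : z ∈ S.coverSpan v) (m : ℕ) :
    projVec 𝒜 P m z ∈ S.coverSpan v := by
  refine projVec_mem_span ?_ hz m
  rintro _ ⟨e, e', he, he', i, rfl⟩
  have h1 := corank_edge e
  have h2 := corank_edge e'
  rw [he] at h1
  rw [he'] at h2
  by_cases hi : i < corank e.tail
  · obtain ⟨j, hj⟩ := Nat.exists_eq_add_of_lt hi
    refine ⟨j, fun w => ?_⟩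
    rw [coeffVec_sub]
    exact Submodule.sub_mem _ ((coeff_lift_mem hS _ _).1 j (by omega) w)
      ((coeff_lift_mem hS _ _).1 j (by omega) w)
  · refine ⟨0, fun w => ?_⟩
    rw [coeffVec_sub, (coeff_lift_mem hS _ _).2 (by omega), (coeff_lift_mem hS _ _).2 (by omega)]
    simp

/-- Both `eval` and `shift` raise the degree by one; so does `rel v`, and this drives the induction
on the degree below. -/
theorem proj_eval_succ (y : P → A) (m : ℕ) :
    GradedAlgebra.proj 𝒜 (m + 1) (S.eval y) = S.eval (projVec 𝒜 P m y) := by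
  rw [eval, Fintype.linearCombination_apply, Fintype.linearCombination_apply, map_sum]
  refine Finset.sum_congr rfl fun w _ => ?_
  rw [smul_eq_mul, GradedAlgebra.proj_mul_of_right_mem 𝒜 _ (vertex_mem hS w), if_pos (by omega)]
  rfl

theorem proj_eval_zero (y : P → A) : GradedAlgebra.proj 𝒜 0 (S.eval y) = 0 := by
  rw [eval, Fintype.linearCombination_apply, map_sum]
  refine Finset.sum_eq_zero fun w _ => ?_
  rw [smul_eq_mul, GradedAlgebra.proj_mul_of_right_mem 𝒜 _ (vertex_mem hS w), if_neg (by omega)]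

theorem projVec_shift_succ (y : P → A) (m : ℕ) :
    projVec 𝒜 P (m + 1) (S.shift y) = S.shift (projVec 𝒜 P m y) := by
  ext v
  rw [shift, Fintype.linearCombination_apply, Fintype.linearCombination_apply, projVec_apply,
    Finset.sum_apply, Finset.sum_apply, map_sum]
  refine Finset.sum_congr rfl fun w _ => ?_
  rw [Pi.smul_apply, smul_eq_mul, GradedAlgebra.proj_mul_of_right_mem 𝒜 _ (shiftVec_mem hS w v),
    if_pos (by omega)]
  rfl

theorem projVec_shift_zero (y : P → A) : projVec 𝒜 P 0 (S.shift y) = 0 := by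
  ext v
  rw [shift, Fintype.linearCombination_apply, projVec_apply, Finset.sum_apply, map_sum]
  refine Finset.sum_eq_zero fun w _ => ?_
  rw [Pi.smul_apply, smul_eq_mul, GradedAlgebra.proj_mul_of_right_mem 𝒜 _ (shiftVec_mem hS w v),
    if_neg (by omega)]

omit hS [RankedPoset P] [Fintype P] in
theorem projVec_smul_unitVec (a : A) (v : P) (m : ℕ) :
    projVec 𝒜 P m (a • unitVec A v) = GradedAlgebra.proj 𝒜 m a • unitVec A v := by
  ext w
  rw [projVec_apply, Pi.smul_apply, smul_eq_mul,
    GradedAlgebra.proj_mul_of_right_mem 𝒜 _ (unitVec_mem v w), if_pos (Nat.zero_le _)]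
  rfl

theorem projVec_rel_succ (v : P) (y : P → A) (m : ℕ) :
    projVec 𝒜 P (m + 1) (S.rel v y) = S.rel v (projVec 𝒜 P m y) := by
  rw [rel_apply, rel_apply, map_sub, projVec_smul_unitVec, proj_eval_succ hS, projVec_shift_succ hS]

theorem projVec_rel_zero (v : P) (y : P → A) : projVec 𝒜 P 0 (S.rel v y) = 0 := by
  rw [rel_apply, map_sub, projVec_smul_unitVec, proj_eval_zero hS, projVec_shift_zero hS,
    zero_smul, sub_zero]

theorem projVec_mem_relSpan {k : ℕ} {y : P → A} (hy : y ∈ S.relSpan k) (m : ℕ) :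
    projVec 𝒜 P m y ∈ S.relSpan k := by
  induction k generalizing y with
  | zero =>
    rw [relSpan_zero] at hy
    rw [(Submodule.mem_bot A).1 hy, map_zero]
    exact Submodule.zero_mem _
  | succ k ih =>
    obtain ⟨y', hy', z, hz, rfl⟩ := S.exists_eq_add_sum_of_mem_relSpan_succ hy
    rw [map_add, map_sum]
    refine Submodule.add_mem _ (S.relSpan_mono (Nat.le_succ k) (ih hy'))
      (Submodule.sum_mem _ fun v hv => ?_)
    cases m with
    | zero => rw [projVec_rel_zero hS]; exact Submodule.zero_mem _
    | succ m =>
      rw [projVec_rel_succ hS]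
      exact S.rel_mem_relSpan (Finset.mem_filter.1 hv).2.le (projVec_mem_coverSpan hS (hz v) m)

/-- If all relations between the vertex elements are generated by the relations in some `relSpan`,
then the relations between the vertex elements of corank at most `k` are generated by the relations
of these vertices. -/
theorem mem_relSpan_of_mem_vanishing {N : ℕ}
    (hN : ∀ y : P → A, y ⊤ = 0 → S.eval y = 0 → y ∈ S.relSpan N) (m : ℕ) :
    ∀ (k : ℕ) (y : P → A), y ∈ vanishing A P k → (∀ w, y w ∈ 𝒜 m) → S.eval y = 0 →
      y ∈ S.relSpan k := by
  induction m with
  | zero =>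
    intro k y hy hm h0
    -- Relations have no component of degree 0, so `y` is zero.
    have key : ∀ l, ∀ y ∈ S.relSpan l, projVec 𝒜 P 0 y = 0 := by
      intro l
      induction l with
      | zero =>
        intro y hy
        rw [relSpan_zero] at hy
        rw [(Submodule.mem_bot A).1 hy, map_zero]
      | succ l ih =>
        intro y hy
        obtain ⟨y', hy', z, hz, rfl⟩ := S.exists_eq_add_sum_of_mem_relSpan_succ hy
        rw [map_add, map_sum, ih _ hy', zero_add]
        exact Finset.sum_eq_zero fun v _ => projVec_rel_zero hS v _
    have h1 := key _ _ (hN y (hy ⊤ (Or.inl rfl)) h0)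
    rw [projVec_of_forall_mem hm] at h1
    rw [h1]
    exact Submodule.zero_mem _
  | succ m ihm =>
    intro k y hy hm h0
    -- The bound `l` is lowered one layer at a time, as long as it exceeds `k`.
    have key : ∀ l, y ∈ S.relSpan l → y ∈ S.relSpan k := by
      intro l
      induction l with
      | zero => exact fun h => S.relSpan_mono (Nat.zero_le k) h
      | succ l ih =>
        intro hl
        rcases Nat.lt_or_ge l k with hlk | hlk
        · exact S.relSpan_mono hlk hl
        refine ih ?_
        obtain ⟨y', hy', z, hz, h⟩ := S.exists_eq_add_sum_of_mem_relSpan_succ hl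
        have h1 := congrArg (projVec 𝒜 P (m + 1)) h
        rw [projVec_of_forall_mem hm, map_add, map_sum] at h1
        have hy'' := projVec_mem_relSpan hS hy' (m + 1)
        have hz' (v : P) := projVec_mem_coverSpan hS (hz v) m
        rw [h1]
        refine Submodule.add_mem _ hy'' (Submodule.sum_mem _ fun v hv => ?_)
        have hv' := (Finset.mem_filter.1 hv).2
        have hv0 : v ≠ ⊤ := by
          rintro rfl
          simp at hv'
        have hvan := S.coverSpan_le_vanishing hv' (hz' v)
        -- At `v`, of corank `l + 1`, `y` vanishes because `k ≤ l`, and so does the part from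
        -- `relSpan l`. Of the top layer only the leading term of the relation of `v` itself
        -- contributes there.
        have h2 : S.eval (projVec 𝒜 P m (z v)) = 0 := by
          have h3 := congrFun h1 v
          rw [hy v (Or.inr (by omega)), Pi.add_apply,
            S.relSpan_le_vanishing l hy'' v (Or.inr (by omega)), zero_add, Finset.sum_apply,
            Finset.sum_eq_single_of_mem v hv, projVec_rel_succ hS,
            S.rel_apply_of_mem hvan (by omega), unitVec, if_neg hv0, Pi.single_eq_same,
            mul_one] at h3
          · exact h3.symm
          · intro w hw hwv
            rw [projVec_rel_succ hS, S.rel_apply_of_mem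
              (S.coverSpan_le_vanishing (Finset.mem_filter.1 hw).2 (hz' w)) (by omega)]
            unfold unitVec
            split_ifs
            · simp
            · rw [Pi.single_eq_of_ne hwv.symm, mul_zero]
        -- Without leading term the relation is minus the shift of a vector which is itself a
        -- relation, of degree `m` and with support of corank at most `l`. The induction on the
        -- degree puts that vector in `relSpan l`, which `shift` preserves.
        rw [projVec_rel_succ hS, rel_apply, h2, zero_smul, zero_sub]
        exact Submodule.neg_mem _ (S.shift_mem_relSpan
          (ihm l _ hvan (fun w => GradedAlgebra.proj_mem 𝒜 m _) h2))
    exact key N (hN y (hy ⊤ (Or.inl rfl)) h0)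

end DescentSystem

end

/-! ### Dimension counts for relations, cover ideals and difference ideals. -/

section

open Polynomial RankedPoset Module

section LinearAlgebra

variable {F V W ι : Type*} [Field F] [AddCommGroup V] [Module F V] [AddCommGroup W] [Module F W]

theorem Submodule.finrank_map_add_finrank_inf_ker (f : V →ₗ[F] W) (N : Submodule F V)
    [FiniteDimensional F N] :
    finrank F (N.map f) + finrank F (N ⊓ LinearMap.ker f : Submodule F V) = finrank F N := by
  rw [← LinearMap.finrank_range_add_finrank_ker (f.domRestrict N), LinearMap.range_domRestrict,
    LinearMap.ker_domRestrict]
  congr 1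
  rw [← Submodule.map_comap_subtype, Submodule.finrank_map_subtype_eq]

variable [Fintype ι] (q : ι → Submodule F V) [∀ i, FiniteDimensional F (q i)]

/-- A product of submodules is the product of the underlying modules. -/
def Submodule.piUnivEquiv : Submodule.pi Set.univ q ≃ₗ[F] ∀ i, q i where
  toFun x i := ⟨x.1 i, x.2 i (Set.mem_univ i)⟩
  invFun x := ⟨fun i => x i, fun i _ => (x i).2⟩
  map_add' _ _ := rfl
  map_smul' _ _ := rfl

instance Submodule.finiteDimensional_pi_univ : FiniteDimensional F (Submodule.pi Set.univ q) :=
  (Submodule.piUnivEquiv q).symm.finiteDimensional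

theorem Submodule.finrank_pi_univ :
    finrank F (Submodule.pi Set.univ q) = ∑ i, finrank F (q i) := by
  rw [(Submodule.piUnivEquiv q).finrank_eq, finrank_pi_fintype]

theorem Submodule.map_sum_proj_pi_univ [DecidableEq ι] :
    (Submodule.pi Set.univ q).map (∑ i, LinearMap.proj i : (ι → V) →ₗ[F] V) = ⨆ i, q i := by
  apply le_antisymm
  · rintro _ ⟨x, hx, rfl⟩
    rw [LinearMap.sum_apply]
    exact Submodule.sum_mem _ fun i _ => Submodule.mem_iSup_of_mem i (hx i (Set.mem_univ i))
  · refine iSup_le fun i x hx => ⟨Pi.single i x, fun j _ => ?_, by simp⟩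
    by_cases h : j = i
    · subst h
      simpa using hx
    · rw [Pi.single_eq_of_ne h]
      exact Submodule.zero_mem _

theorem Submodule.finrank_iSup_add_finrank_ker [DecidableEq ι] :
    finrank F (⨆ i, q i : Submodule F V) + finrank F (Submodule.pi Set.univ q ⊓
      LinearMap.ker (∑ i, LinearMap.proj i : (ι → V) →ₗ[F] V) : Submodule F (ι → V)) =
      ∑ i, finrank F (q i) := by
  rw [← Submodule.map_sum_proj_pi_univ, Submodule.finrank_map_add_finrank_inf_ker,
    Submodule.finrank_pi_univ]

end LinearAlgebra

namespace DescentSystem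

variable {P : Type*} [PartialOrder P] [OrderTop P] [RankedPoset P] [Fintype P] [DecidableEq P]
  {F A : Type*} [Field F] [Ring A] [Algebra F A] {𝒜 : ℕ → Submodule F A} [GradedAlgebra 𝒜]
  {S : DescentSystem P A}

variable (𝒜) in
/-- The homogeneous component of a left ideal. -/
def idealPart (D : Submodule A A) (m : ℕ) : Submodule F A := D.restrictScalars F ⊓ 𝒜 m

instance finiteDimensional_idealPart [∀ m, Module.Finite F (𝒜 m)] (D : Submodule A A) (m : ℕ) :
    FiniteDimensional F (idealPart 𝒜 D m) :=
  Submodule.finiteDimensional_inf_right _ _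

instance finiteDimensional_ite (p : Prop) [Decidable p] (N : Submodule F A)
    [FiniteDimensional F N] : FiniteDimensional F (if p then N else ⊥ : Submodule F A) := by
  by_cases h : p
  · rw [if_pos h]; infer_instance
  · rw [if_neg h]; infer_instance

omit [GradedAlgebra 𝒜] in
theorem finrank_ite (p : Prop) [Decidable p] (N : Submodule F A) :
    finrank F (if p then N else ⊥ : Submodule F A) = if p then finrank F N else 0 := by
  by_cases h : p
  · rw [if_pos h, if_pos h]
  · rw [if_neg h, if_neg h, finrank_bot]

theorem exists_eval_eq_of_mem (hgen : ∀ m, ∀ a ∈ 𝒜 (m + 1), ∃ y : P → A, S.eval y = a)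
    {m : ℕ} {a : A} (ha : a ∈ 𝒜 (m + 1)) (hS : ∀ e, S.edge e ∈ 𝒜 1) :
    ∃ y : P → A, y ⊤ = 0 ∧ (∀ w, y w ∈ 𝒜 m) ∧ S.eval y = a := by
  obtain ⟨y, hy⟩ := hgen m a ha
  -- The coordinate at ⊤ can be dropped because x_⊤ = 0.
  refine ⟨projVec 𝒜 P m (y - Pi.single ⊤ (y ⊤)), by simp,
    fun w => GradedAlgebra.proj_mem 𝒜 m _, ?_⟩
  have h : S.eval (y - Pi.single ⊤ (y ⊤)) = a := by
    rw [map_sub, hy]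
    simp [eval]
  rw [← proj_eval_succ hS, h, GradedAlgebra.proj_of_mem 𝒜 ha]

theorem proj_mem_coverIdeal (hS : ∀ e, S.edge e ∈ 𝒜 1) {v : P} {d : A}
    (hd : d ∈ S.coverIdeal v) (m : ℕ) : GradedAlgebra.proj 𝒜 m d ∈ S.coverIdeal v := by
  obtain ⟨z, hz, rfl⟩ := hd
  cases m with
  | zero => rw [proj_eval_zero hS]; exact Submodule.zero_mem _
  | succ m => rw [proj_eval_succ hS]; exact Submodule.mem_map_of_mem (projVec_mem_coverSpan hS hz m)

theorem exists_eval_eq_mul_vertex (hS : ∀ e, S.edge e ∈ 𝒜 1) {v : P} {k m : ℕ}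
    (hv : corank v = k + 1) {d : A} (hd : d ∈ S.coverIdeal v) (hm : d ∈ 𝒜 m) :
    ∃ y ∈ vanishing A P k, (∀ w, y w ∈ 𝒜 m) ∧ S.eval y = d * S.vertex v := by
  obtain ⟨z, hz, rfl⟩ := hd
  have h1 := S.shift_mem_vanishing (S.coverSpan_le_vanishing hv hz)
  refine ⟨projVec 𝒜 P m (S.shift z), fun w hw => ?_, fun w => GradedAlgebra.proj_mem 𝒜 m _, ?_⟩
  · rw [projVec_apply, h1 w hw, map_zero]
  · rw [← proj_eval_succ hS, S.eval_shift_eq hz, GradedAlgebra.proj_of_mem 𝒜]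
    exact SetLike.mul_mem_graded hm (vertex_mem hS v)

variable (S) in
/-- The linear relations with coefficients of degree `m` between the vertex elements of corank at
most `k`. -/
noncomputable def relations (𝒜 : ℕ → Submodule F A) (k m : ℕ) : Submodule F (P → A) :=
  Submodule.pi Set.univ (fun w => if w ≠ ⊤ ∧ corank w ≤ k then 𝒜 m else ⊥) ⊓
    LinearMap.ker (S.eval.restrictScalars F)

omit [GradedAlgebra 𝒜] in
theorem mem_pi_ite {p : P → Prop} [DecidablePred p] {N : P → Submodule F A} {y : P → A} :
    y ∈ Submodule.pi Set.univ (fun w => if p w then N w else ⊥) ↔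
      ∀ w, y w ∈ N w ∧ (¬ p w → y w = 0) := by
  rw [Submodule.mem_pi]
  refine ⟨fun h w => ?_, fun h w _ => ?_⟩
  · have := h w (Set.mem_univ w)
    split_ifs at this with hw
    · exact ⟨this, fun h => absurd hw h⟩
    · rw [(Submodule.mem_bot F).1 this]
      exact ⟨Submodule.zero_mem _, fun _ => rfl⟩
  · split_ifs with hw
    · exact (h w).1
    · exact (Submodule.mem_bot F).2 ((h w).2 hw)

omit [GradedAlgebra 𝒜] in
theorem mem_relations {k m : ℕ} {y : P → A} : y ∈ S.relations 𝒜 k m ↔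
    y ∈ vanishing A P k ∧ (∀ w, y w ∈ 𝒜 m) ∧ S.eval y = 0 := by
  rw [relations, Submodule.mem_inf, mem_pi_ite]
  constructor
  · rintro ⟨h1, h2⟩
    refine ⟨fun w hw => (h1 w).2 ?_, fun w => (h1 w).1, h2⟩
    rintro ⟨h3, h4⟩
    rcases hw with hw | hw
    · exact h3 hw
    · omega
  · rintro ⟨h1, h2, h3⟩
    refine ⟨fun w => ⟨h2 w, fun hw => h1 w ?_⟩, h3⟩
    by_cases hw' : w = ⊤
    · exact Or.inl hw'
    · exact Or.inr (by by_contra h; exact hw ⟨hw', by omega⟩)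

variable [∀ m, Module.Finite F (𝒜 m)]

instance finiteDimensional_relations (k m : ℕ) : FiniteDimensional F (S.relations 𝒜 k m) :=
  Submodule.finiteDimensional_inf_left _ _

/-- The restriction of a vector to a set of indices. -/
def restrictVec (F A : Type*) [Field F] [Ring A] [Algebra F A] {P : Type*} (p : P → Prop)
    [DecidablePred p] : (P → A) →ₗ[F] (P → A) :=
  LinearMap.pi fun w => if p w then LinearMap.proj w else 0

omit [PartialOrder P] [OrderTop P] [RankedPoset P] [Fintype P] [DecidableEq P] in
theorem restrictVec_apply (p : P → Prop) [DecidablePred p] (y : P → A) (w : P) :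
    restrictVec F A p y w = if p w then y w else 0 := by
  rw [restrictVec, LinearMap.pi_apply]
  split_ifs <;> rfl

/-- Restrict a relation to its coordinates of corank `k + 1`. The kernel consists of the relations
of corank at most `k`. The image is the product of the degree-`m` parts of the cover ideals:
`apply_mem_coverIdeal` bounds it, and `exists_eval_eq_mul_vertex` completes any such tuple to a
relation. -/
theorem finrank_relations_succ (hS : ∀ e, S.edge e ∈ 𝒜 1) {N : ℕ}
    (hN : ∀ y : P → A, y ⊤ = 0 → S.eval y = 0 → y ∈ S.relSpan N) (k m : ℕ) :
    finrank F (S.relations 𝒜 (k + 1) m) = finrank F (S.relations 𝒜 k m) +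
      ∑ v with corank v = k + 1, finrank F (idealPart 𝒜 (S.coverIdeal v) m) := by
  rw [← Submodule.finrank_map_add_finrank_inf_ker (restrictVec F A fun w : P => corank w = k + 1)]
  have h1 : S.relations 𝒜 (k + 1) m ⊓
      LinearMap.ker (restrictVec F A fun w : P => corank w = k + 1) = S.relations 𝒜 k m := by
    ext y
    rw [Submodule.mem_inf, mem_relations, mem_relations, LinearMap.mem_ker]
    constructor
    · rintro ⟨⟨h1, h2, h3⟩, h4⟩
      refine ⟨fun w hw => ?_, h2, h3⟩
      rcases hw with hw | hw
      · exact h1 w (Or.inl hw)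
      · rcases (Nat.succ_le_of_lt hw).eq_or_lt with h | h
        · have := congrFun h4 w
          rwa [restrictVec_apply, if_pos h.symm] at this
        · exact h1 w (Or.inr h)
    · rintro ⟨h1, h2, h3⟩
      refine ⟨⟨vanishing_mono (Nat.le_succ k) h1, h2, h3⟩, ?_⟩
      ext w
      rw [restrictVec_apply]
      split_ifs with h
      · exact h1 w (Or.inr (by omega))
      · rfl
  have h2 : (S.relations 𝒜 (k + 1) m).map (restrictVec F A fun w : P => corank w = k + 1) =
      Submodule.pi Set.univ
        (fun w => if corank w = k + 1 then idealPart 𝒜 (S.coverIdeal w) m else ⊥) := by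
    ext b
    rw [mem_pi_ite]
    constructor
    · rintro ⟨y, hy, rfl⟩ w
      obtain ⟨h1, h2, h3⟩ := mem_relations.1 hy
      rw [restrictVec_apply]
      split_ifs with h
      · refine ⟨⟨?_, h2 w⟩, fun h' => absurd h h'⟩
        exact S.apply_mem_coverIdeal (h ▸ mem_relSpan_of_mem_vanishing hS hN m (k + 1) y h1 h2 h3)
      · exact ⟨Submodule.zero_mem _, fun _ => rfl⟩
    · intro hb
      have h3 (w : P) : ∃ y ∈ vanishing A P k, (∀ u, y u ∈ 𝒜 m) ∧
          S.eval y = b w * S.vertex w := by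
        by_cases hw : corank w = k + 1
        · exact exists_eval_eq_mul_vertex hS hw (hb w).1.1 (hb w).1.2
        · exact ⟨0, Submodule.zero_mem _, fun _ => Submodule.zero_mem _, by simp [(hb w).2 hw]⟩
      choose y hy1 hy2 hy3 using h3
      refine ⟨b - ∑ w, y w, mem_relations.2 ⟨?_, fun w => ?_, ?_⟩, ?_⟩
      · refine Submodule.sub_mem _ (fun w hw => (hb w).2 ?_)
          (Submodule.sum_mem _ fun w _ => vanishing_mono (Nat.le_succ k) (hy1 w))
        rcases hw with hw | hw
        · rw [hw, corank_top]
          omega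
        · omega
      · rw [Pi.sub_apply, Finset.sum_apply]
        exact Submodule.sub_mem _ (hb w).1.2 (Submodule.sum_mem _ fun u _ => hy2 u w)
      · rw [map_sub, map_sum, sub_eq_zero, eval, Fintype.linearCombination_apply]
        exact Finset.sum_congr rfl fun w _ => (hy3 w).symm
      · ext w
        rw [restrictVec_apply, Pi.sub_apply, Finset.sum_apply]
        split_ifs with h
        · rw [Finset.sum_eq_zero fun u _ => hy1 u w (Or.inr (by omega)), sub_zero]
        · exact ((hb w).2 h).symm
  rw [h1, h2, Submodule.finrank_pi_univ, add_comm, Finset.sum_filter]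
  congr 1
  exact Finset.sum_congr rfl fun w _ => finrank_ite _ _

theorem finrank_relations (hS : ∀ e, S.edge e ∈ 𝒜 1) {N : ℕ}
    (hN : ∀ y : P → A, y ⊤ = 0 → S.eval y = 0 → y ∈ S.relSpan N) (k m : ℕ) :
    finrank F (S.relations 𝒜 k m) = ∑ v with v ≠ ⊤ ∧ corank v ≤ k,
      finrank F (idealPart 𝒜 (S.coverIdeal v) m) := by
  induction k with
  | zero =>
    have h : S.relations 𝒜 0 m = ⊥ := by
      rw [eq_bot_iff]
      intro y hy
      obtain ⟨h1, -, -⟩ := mem_relations.1 hy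
      rw [Submodule.mem_bot]
      ext w
      by_cases hw : w = ⊤
      · exact h1 w (Or.inl hw)
      · exact h1 w (Or.inr (corank_pos hw))
    rw [h, finrank_bot, eq_comm]
    refine Finset.sum_eq_zero fun v hv => ?_
    obtain ⟨h1, h2⟩ := (Finset.mem_filter.1 hv).2
    exact absurd (corank_pos h1) (by omega)
  | succ k ih =>
    rw [finrank_relations_succ hS hN, ih, ← Finset.sum_union]
    · congr 1
      ext v
      simp only [Finset.mem_union, Finset.mem_filter, Finset.mem_univ, true_and]
      have : corank v = k + 1 → v ≠ ⊤ := by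
        rintro h rfl
        simp at h
      grind
    · rw [Finset.disjoint_filter]
      intro v _ h h'
      omega

/-- The dimension of a homogeneous component of positive degree. -/
theorem finrank_succ (hS : ∀ e, S.edge e ∈ 𝒜 1) {N : ℕ}
    (hN : ∀ y : P → A, y ⊤ = 0 → S.eval y = 0 → y ∈ S.relSpan N)
    (hgen : ∀ m, ∀ a ∈ 𝒜 (m + 1), ∃ y : P → A, S.eval y = a) (m : ℕ) :
    finrank F (𝒜 (m + 1)) + ∑ v with v ≠ ⊤, finrank F (idealPart 𝒜 (S.coverIdeal v) m) =
      ∑ v : P with v ≠ ⊤, finrank F (𝒜 m) := by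
  have hle (v : P) : corank v ≤ RankedPoset.rank (⊤ : P) := Nat.sub_le _ _
  have h1 := finrank_relations hS hN (RankedPoset.rank (⊤ : P)) m
  have h2 := Submodule.finrank_map_add_finrank_inf_ker (S.eval.restrictScalars F)
    (Submodule.pi Set.univ
      (fun w : P => if w ≠ ⊤ ∧ corank w ≤ RankedPoset.rank (⊤ : P) then 𝒜 m else ⊥))
  have h3 : (Submodule.pi Set.univ
      (fun w : P => if w ≠ ⊤ ∧ corank w ≤ RankedPoset.rank (⊤ : P) then 𝒜 m else ⊥)).map
        (S.eval.restrictScalars F) = 𝒜 (m + 1) := by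
    ext a
    constructor
    · rintro ⟨y, hy, rfl⟩
      have hy' := mem_pi_ite.1 hy
      rw [LinearMap.restrictScalars_apply, eval, Fintype.linearCombination_apply]
      exact Submodule.sum_mem _ fun w _ => SetLike.mul_mem_graded (hy' w).1 (vertex_mem hS w)
    · intro ha
      obtain ⟨y, hy1, hy2, rfl⟩ := exists_eval_eq_of_mem hgen ha hS
      refine ⟨y, mem_pi_ite.2 fun w => ⟨hy2 w, fun hw => ?_⟩, rfl⟩
      have : w = ⊤ := by
        by_contra h
        exact hw ⟨h, hle w⟩
      rw [this, hy1]
  rw [h3, Submodule.finrank_pi_univ, ← relations, h1] at h2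
  simp only [finrank_ite, hle, and_true] at h2
  rw [h2, Finset.sum_filter]

variable (S) in
/-- The left ideal generated by the differences of the vertex elements of a set of vertices. -/
def diffIdeal (p : P → Prop) : Submodule A A :=
  Submodule.span A {d | ∃ u u', p u ∧ p u' ∧ d = S.vertex u - S.vertex u'}

omit [∀ m, Module.Finite F (𝒜 m)] in
theorem exists_eval_eq_of_mem_diffIdeal {p : P → Prop} (hp : ∀ u, p u → u ≠ ⊤) {d : A}
    (hd : d ∈ S.diffIdeal p) :
    ∃ y : P → A, (∀ u, ¬ p u → y u = 0) ∧ ∑ u, y u = 0 ∧ S.eval y = d := by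
  have hu {u : P} (h : p u) : ∑ w, unitVec A u w = 1 := by
    simp [unitVec, hp u h]
  have hu' {u w : P} (h : p u) (hw : ¬ p w) : unitVec A u w = 0 := by
    rw [unitVec, if_neg (hp u h), Pi.single_eq_of_ne]
    rintro rfl
    exact hw h
  induction hd using Submodule.span_induction with
  | mem d hd =>
    obtain ⟨u, u', h, h', rfl⟩ := hd
    refine ⟨unitVec A u - unitVec A u', fun w hw => ?_, ?_, ?_⟩
    · rw [Pi.sub_apply, hu' h hw, hu' h' hw, sub_zero]
    · simp only [Pi.sub_apply, Finset.sum_sub_distrib, hu h, hu h', sub_self]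
    · rw [map_sub, eval_unitVec, eval_unitVec]
  | zero => exact ⟨0, fun _ _ => rfl, by simp, map_zero _⟩
  | add a b _ _ ha hb =>
    obtain ⟨y, h1, h2, h3⟩ := ha
    obtain ⟨z, h4, h5, h6⟩ := hb
    refine ⟨y + z, fun u hu => ?_, ?_, ?_⟩
    · rw [Pi.add_apply, h1 u hu, h4 u hu, add_zero]
    · simp only [Pi.add_apply, Finset.sum_add_distrib, h2, h5, add_zero]
    · rw [map_add, h3, h6]
  | smul a b _ hb =>
    obtain ⟨z, h4, h5, h6⟩ := hb
    refine ⟨a • z, fun u hu => ?_, ?_, ?_⟩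
    · rw [Pi.smul_apply, h4 u hu, smul_zero]
    · simp only [Pi.smul_apply, ← Finset.smul_sum, h5, smul_zero]
    · rw [map_smul, h6]

/-- The dimension of the homogeneous components of the left ideal generated by the differences of
the vertex elements of some vertices of the same corank. -/
theorem finrank_diffIdeal_succ (hS : ∀ e, S.edge e ∈ 𝒜 1) {N : ℕ}
    (hN : ∀ y : P → A, y ⊤ = 0 → S.eval y = 0 → y ∈ S.relSpan N) {p : P → Prop} [DecidablePred p]
    {k : ℕ} (hp : ∀ u, p u → corank u = k + 1) {u₀ : P} (hu₀ : p u₀) (m : ℕ) :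
    finrank F (idealPart 𝒜 (S.diffIdeal p) (m + 1)) +
        ∑ u with p u, finrank F (idealPart 𝒜 (S.coverIdeal u) m) + finrank F (𝒜 m) =
      ∑ u with p u, finrank F (𝒜 m) +
        finrank F (idealPart 𝒜 (⨆ u, if p u then S.coverIdeal u else ⊥) m) := by
  have hp' (u : P) (hu : p u) : u ≠ ⊤ := by
    rintro rfl
    have := hp _ hu
    simp at this
  -- Rank-nullity for the addition map on vectors supported on `p`: here with entries in A_m, next
  -- with entries in the cover ideals. Their kernels are the vectors of coordinate sum zero.
  have h1 := Submodule.finrank_iSup_add_finrank_ker (fun u : P => if p u then 𝒜 m else ⊥)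
  have h2 := Submodule.finrank_iSup_add_finrank_ker
    (fun u : P => if p u then idealPart 𝒜 (S.coverIdeal u) m else ⊥)
  have h3 : (⨆ u : P, if p u then 𝒜 m else ⊥) = 𝒜 m := by
    apply le_antisymm
    · refine iSup_le fun u => ?_
      split_ifs
      · exact le_rfl
      · exact bot_le
    · refine le_iSup_of_le u₀ ?_
      rw [if_pos hu₀]
  have h4 : (⨆ u : P, if p u then idealPart 𝒜 (S.coverIdeal u) m else ⊥) =
      idealPart 𝒜 (⨆ u, if p u then S.coverIdeal u else ⊥) m := by
    apply le_antisymm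
    · refine iSup_le fun u => ?_
      split_ifs with hu
      · refine fun a ha => ⟨?_, ha.2⟩
        exact Submodule.mem_iSup_of_mem u (by rw [if_pos hu]; exact ha.1)
      · exact bot_le
    · rintro a ⟨ha, ham⟩
      have key : GradedAlgebra.proj 𝒜 m a ∈
          ⨆ u : P, if p u then idealPart 𝒜 (S.coverIdeal u) m else ⊥ := by
        refine Submodule.iSup_induction _ (motive := fun a => GradedAlgebra.proj 𝒜 m a ∈
          ⨆ u : P, if p u then idealPart 𝒜 (S.coverIdeal u) m else ⊥) ha (fun u x hx => ?_) ?_ ?_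
        · refine Submodule.mem_iSup_of_mem u ?_
          split_ifs at hx ⊢
          · exact ⟨proj_mem_coverIdeal hS hx m, GradedAlgebra.proj_mem 𝒜 m x⟩
          · rw [(Submodule.mem_bot A).1 hx, map_zero]
            exact Submodule.zero_mem _
        · rw [map_zero]
          exact Submodule.zero_mem _
        · intro x y hx hy
          rw [map_add]
          exact Submodule.add_mem _ hx hy
      rwa [GradedAlgebra.proj_of_mem 𝒜 ham] at key
  -- The third count is for `eval` on the sum-zero vectors over A_m: its image is the difference
  -- ideal in degree `m + 1` (`h6`), and its kernel is the second sum-zero space (`h7`).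
  have h5 := Submodule.finrank_map_add_finrank_inf_ker (S.eval.restrictScalars F)
    (Submodule.pi Set.univ (fun u : P => if p u then 𝒜 m else ⊥) ⊓
      LinearMap.ker (∑ i, LinearMap.proj i : (P → A) →ₗ[F] A))
  have h6 : (Submodule.pi Set.univ (fun u : P => if p u then 𝒜 m else ⊥) ⊓
      LinearMap.ker (∑ i, LinearMap.proj i : (P → A) →ₗ[F] A)).map (S.eval.restrictScalars F) =
      idealPart 𝒜 (S.diffIdeal p) (m + 1) := by
    ext d
    constructor
    · rintro ⟨y, ⟨hy, hy'⟩, rfl⟩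
      have hy := mem_pi_ite.1 hy
      rw [SetLike.mem_coe, LinearMap.mem_ker, LinearMap.sum_apply] at hy'
      simp only [LinearMap.proj_apply] at hy'
      rw [LinearMap.restrictScalars_apply, eval, Fintype.linearCombination_apply]
      refine ⟨?_, Submodule.sum_mem _ fun u _ =>
        SetLike.mul_mem_graded (hy u).1 (vertex_mem hS u)⟩
      have h : ∑ u, y u • S.vertex u = ∑ u, y u • (S.vertex u - S.vertex u₀) := by
        simp only [smul_sub, Finset.sum_sub_distrib, ← Finset.sum_smul, hy', zero_smul, sub_zero]
      rw [h]
      change _ ∈ S.diffIdeal p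
      refine Submodule.sum_mem _ fun u _ => ?_
      by_cases hu : p u
      · exact Submodule.smul_mem _ _ (Submodule.subset_span ⟨u, u₀, hu, hu₀, rfl⟩)
      · rw [(hy u).2 hu, zero_smul]
        exact Submodule.zero_mem _
    · rintro ⟨hd, hdm⟩
      obtain ⟨y, hy1, hy2, rfl⟩ := exists_eval_eq_of_mem_diffIdeal hp' hd
      refine ⟨projVec 𝒜 P m y, ⟨mem_pi_ite.2 fun u => ⟨GradedAlgebra.proj_mem 𝒜 m _, fun hu => ?_⟩,
        ?_⟩, ?_⟩
      · rw [projVec_apply, hy1 u hu, map_zero]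
      · rw [SetLike.mem_coe, LinearMap.mem_ker, LinearMap.sum_apply]
        simp only [LinearMap.proj_apply, projVec_apply]
        rw [← map_sum, hy2, map_zero]
      · rw [LinearMap.restrictScalars_apply, ← proj_eval_succ hS, GradedAlgebra.proj_of_mem 𝒜 hdm]
  have h7 : Submodule.pi Set.univ (fun u : P => if p u then 𝒜 m else ⊥) ⊓
      LinearMap.ker (∑ i, LinearMap.proj i : (P → A) →ₗ[F] A) ⊓
      LinearMap.ker (S.eval.restrictScalars F) =
      Submodule.pi Set.univ (fun u : P => if p u then idealPart 𝒜 (S.coverIdeal u) m else ⊥) ⊓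
      LinearMap.ker (∑ i, LinearMap.proj i : (P → A) →ₗ[F] A) := by
    ext y
    simp only [Submodule.mem_inf, mem_pi_ite]
    constructor
    · rintro ⟨⟨hy, hy'⟩, h0⟩
      refine ⟨fun u => ⟨⟨?_, (hy u).1⟩, (hy u).2⟩, hy'⟩
      by_cases hu : p u
      · refine S.apply_mem_coverIdeal ?_
        rw [hp u hu]
        refine mem_relSpan_of_mem_vanishing hS hN m (k + 1) y (fun w hw => (hy w).2 fun hpw => ?_)
          (fun w => (hy w).1) h0
        rcases hw with hw | hw
        · exact hp' w hpw hw
        · exact absurd (hp w hpw) (by omega)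
      · rw [(hy u).2 hu]
        exact Submodule.zero_mem _
    · rintro ⟨hy, hy'⟩
      refine ⟨⟨fun u => ⟨(hy u).1.2, (hy u).2⟩, hy'⟩, ?_⟩
      have h (u : P) : ∃ z : P → A, z ∈ vanishing A P k ∧ S.eval z = y u ∧
          S.eval (S.shift z) = y u * S.vertex u := by
        by_cases hu : p u
        · obtain ⟨z, hz, hz'⟩ := (hy u).1.1
          exact ⟨z, S.coverSpan_le_vanishing (hp u hu) hz, hz', by rw [S.eval_shift_eq hz, hz']⟩
        · exact ⟨0, Submodule.zero_mem _, by simp [(hy u).2 hu], by simp [(hy u).2 hu]⟩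
      choose z hz1 hz2 hz3 using h
      rw [LinearMap.mem_ker, LinearMap.sum_apply] at hy'
      simp only [LinearMap.proj_apply] at hy'
      -- Here y_u = eval z_u and y_u x_u = eval (shift z_u). If the y_u sum to zero, then Σ z_u is a
      -- relation; so is its shift, and therefore Σ y_u x_u = 0.
      have h8 : S.eval (∑ u, z u) = 0 := by
        rw [map_sum, ← hy']
        exact Finset.sum_congr rfl fun u _ => hz2 u
      have hv : ∑ u, z u ∈ vanishing A P k := Submodule.sum_mem _ fun u _ => hz1 u
      have h9 := hN (∑ u, z u) (hv ⊤ (Or.inl rfl)) h8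
      have h10 := S.eval_eq_zero_of_mem_relSpan (S.shift_mem_relSpan h9)
      rw [map_sum, map_sum] at h10
      rw [LinearMap.mem_ker, LinearMap.restrictScalars_apply, ← h10, eval,
        Fintype.linearCombination_apply]
      exact Finset.sum_congr rfl fun u _ => (hz3 u).symm
  rw [h3] at h1
  rw [h4] at h2
  rw [h6, h7] at h5
  simp only [finrank_ite, ← Finset.sum_filter] at h1 h2
  omega

omit [∀ m, Module.Finite F (𝒜 m)] in
theorem idealPart_diffIdeal_zero (hS : ∀ e, S.edge e ∈ 𝒜 1) {p : P → Prop}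
    (hp : ∀ u, p u → u ≠ ⊤) : idealPart 𝒜 (S.diffIdeal p) 0 = ⊥ := by
  rw [eq_bot_iff]
  rintro d ⟨hd, hdm⟩
  obtain ⟨y, -, -, rfl⟩ := exists_eval_eq_of_mem_diffIdeal hp hd
  rw [Submodule.mem_bot, ← GradedAlgebra.proj_of_mem 𝒜 hdm, proj_eval_zero hS]

omit [∀ m, Module.Finite F (𝒜 m)] in
theorem idealPart_bot (m : ℕ) : idealPart 𝒜 (⊥ : Submodule A A) m = ⊥ := by
  rw [eq_bot_iff]
  rintro d ⟨hd, -⟩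
  exact hd

end DescentSystem

end

/-! ### Uniform posets and the linear system for the Hilbert series. -/

section

open Polynomial RankedPoset Module

namespace RankedPoset

variable {P : Type*} [PartialOrder P] [OrderTop P] [RankedPoset P] [Finite P]

theorem corank_anti {v u : P} (h : v ≤ u) : corank u ≤ corank v := by
  induction v using WellFoundedGT.induction with
  | ind v ih =>
    rcases h.eq_or_lt with rfl | h
    · exact le_rfl
    · obtain ⟨w, hw, hwu⟩ := IsStronglyAtomic.exists_covBy_le_of_lt v u h
      have := ih w hw.lt hwu
      have := corank_covBy hw
      omega

theorem corank_lt {v u : P} (h : v < u) : corank u < corank v := by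
  obtain ⟨w, hw, hwu⟩ := IsStronglyAtomic.exists_covBy_le_of_lt v u h
  have := corank_anti hwu
  have := corank_covBy hw
  omega

theorem exists_le_corank_eq {v : P} {k : ℕ} (hk : k ≤ corank v) : ∃ u, v ≤ u ∧ corank u = k := by
  induction v using WellFoundedGT.induction with
  | ind v ih =>
    rcases hk.eq_or_lt with rfl | hk
    · exact ⟨v, le_rfl, rfl⟩
    · have hv : v ≠ ⊤ := by
        rintro rfl
        simp at hk
      obtain ⟨w, hw⟩ := exists_covBy_of_ne_top hv
      have := corank_covBy hw
      obtain ⟨u, hu, hu'⟩ := ih w hw.lt (by omega)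
      exact ⟨u, hw.le.trans hu, hu'⟩

/-- Two elements with a common upper cover and a common lower cover above `v`. -/
def Linked (v a b : P) : Prop := (∃ w, a ⋖ w ∧ b ⋖ w) ∧ ∃ m, v ≤ m ∧ m ⋖ a ∧ m ⋖ b

/-- A poset is uniform when any two elements of the same rank above an element `v` are connected by
a sequence of elements with common covers, above `v`. -/
def Uniform (P : Type*) [PartialOrder P] [OrderTop P] [RankedPoset P] : Prop :=
  ∀ v u u' : P, v ≤ u → v ≤ u' → corank u = corank u' → Relation.ReflTransGen (Linked v) u u'

end RankedPoset

namespace DescentSystem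

section Uniform

variable {P : Type*} [PartialOrder P] [OrderTop P] [RankedPoset P] [Fintype P] [DecidableEq P]
  {A : Type*} [Ring A] {S : DescentSystem P A}

/-- Follow a chain of linked elements: if w covers b and c, then P_b - P_c = P_w (x_b - x_c). -/
theorem poly_sub_mem_diffIdeal (hP : Uniform P) {v u u' : P} {k : ℕ} (hu : v ≤ u) (hu' : v ≤ u')
    (hk : corank u = k) (hk' : corank u' = k) (i : ℕ) :
    (S.poly u - S.poly u').coeff i ∈ S.diffIdeal fun w => v ≤ w ∧ corank w = k := by
  have key : ∀ b, Relation.ReflTransGen (Linked v) u b → (v ≤ b ∧ corank b = k) ∧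
      (S.poly u - S.poly b).coeff i ∈ S.diffIdeal fun w => v ≤ w ∧ corank w = k := by
    intro b hb
    induction hb with
    | refl => exact ⟨⟨hu, hk⟩, by rw [sub_self, coeff_zero]; exact Submodule.zero_mem _⟩
    | @tail b c _ hbc ih =>
      obtain ⟨⟨hb1, hb2⟩, hb3⟩ := ih
      obtain ⟨⟨w, hbw, hcw⟩, m, hvm, -, hmc⟩ := hbc
      have h1 := corank_covBy hbw
      have h2 := corank_covBy hcw
      have hc : v ≤ c ∧ corank c = k := ⟨hvm.trans hmc.le, by omega⟩
      refine ⟨hc, ?_⟩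
      rw [← sub_add_sub_cancel _ (S.poly b), coeff_add]
      refine Submodule.add_mem _ hb3 ?_
      have h3 : S.poly b - S.poly c = S.poly w * C (S.vertex b - S.vertex c) := by
        have h4 := S.poly_head ⟨w, b, hbw⟩
        have h5 := S.poly_head ⟨w, c, hcw⟩
        rw [S.edge_eq] at h4 h5
        simp only at h4 h5
        rw [h4, h5, ← mul_sub, sub_sub_sub_cancel_left, ← C_sub, sub_sub_sub_cancel_left]
      rw [h3, coeff_mul_C]
      exact Submodule.smul_mem _ _ (Submodule.subset_span ⟨b, c, ⟨hb1, hb2⟩, hc, rfl⟩)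
  exact (key u' (hP v u u' hu hu' (hk.trans hk'.symm))).2

/-- The difference of the vertex elements is the subleading coefficient of P_a - P_b. -/
theorem vertex_sub_mem_coverIdeal {m a b : P} (ha : m ⋖ a) (hb : m ⋖ b) :
    S.vertex a - S.vertex b ∈ S.coverIdeal m := by
  have h1 := corank_covBy ha
  have h2 := corank_covBy hb
  have h3 : corank b = corank a := by omega
  rw [vertex, vertex, h3, ← coeff_sub, ← mul_sub]
  cases corank a with
  | zero => rw [coeff_X_mul_zero]; exact Submodule.zero_mem _
  | succ k =>
    rw [coeff_X_mul, coverIdeal_eq_span]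
    exact Submodule.subset_span ⟨⟨a, m, ha⟩, ⟨b, m, hb⟩, rfl, rfl, k, rfl⟩

-- The two inclusions use the two halves of `Linked`: common upper covers put differences of
-- polynomials into the difference ideal, common lower covers put differences of vertex elements
-- into cover ideals.
open Classical in
theorem iSup_coverIdeal_eq (hP : Uniform P) (v : P) (k : ℕ) :
    (⨆ u, if v ≤ u ∧ corank u = k + 1 then S.coverIdeal u else ⊥) =
      S.diffIdeal fun u => v ≤ u ∧ corank u = k := by
  apply le_antisymm
  · refine iSup_le fun u => ?_
    split_ifs with hu
    · rw [coverIdeal_eq_span, Submodule.span_le]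
      rintro _ ⟨e, e', he, he', i, rfl⟩
      have h1 := corank_edge e
      have h2 := corank_edge e'
      have h3 := e.covBy.le
      have h4 := e'.covBy.le
      rw [he] at h1 h3
      rw [he'] at h2 h4
      exact poly_sub_mem_diffIdeal hP (hu.1.trans h3) (hu.1.trans h4) (by omega) (by omega) i
    · exact bot_le
  · rw [diffIdeal, Submodule.span_le]
    rintro _ ⟨u, u', hu, hu', rfl⟩
    have key : ∀ b, Relation.ReflTransGen (Linked v) u b → corank b = k ∧
        S.vertex u - S.vertex b ∈
          ⨆ u, if v ≤ u ∧ corank u = k + 1 then S.coverIdeal u else ⊥ := by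
      intro b hb
      induction hb with
      | refl => exact ⟨hu.2, by rw [sub_self]; exact Submodule.zero_mem _⟩
      | @tail b c _ hbc ih =>
        obtain ⟨hb2, hb3⟩ := ih
        obtain ⟨-, m, hvm, hmb, hmc⟩ := hbc
        have h1 := corank_covBy hmb
        have h2 := corank_covBy hmc
        refine ⟨by omega, ?_⟩
        rw [← sub_add_sub_cancel _ (S.vertex b)]
        refine Submodule.add_mem _ hb3 (Submodule.mem_iSup_of_mem m ?_)
        rw [if_pos ⟨hvm, by omega⟩]
        exact vertex_sub_mem_coverIdeal hmb hmc
    exact (key u' (hP v u u' hu.1 hu'.1 (hu.2.trans hu'.2.symm))).2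

theorem diffIdeal_eq_bot {p : P → Prop} (hp : ∀ u u', p u → p u' → u = u') :
    S.diffIdeal p = ⊥ := by
  rw [diffIdeal, Submodule.span_eq_bot]
  rintro _ ⟨u, u', hu, hu', rfl⟩
  rw [hp u u' hu hu', sub_self]

end Uniform

section HilbertSeries

open PowerSeries

variable {P : Type*} [PartialOrder P] [OrderTop P] [RankedPoset P] [Fintype P] [DecidableEq P]
  {F A : Type*} [Field F] [Ring A] [Algebra F A] {𝒜 : ℕ → Submodule F A} [GradedAlgebra 𝒜]
  [∀ m, Module.Finite F (𝒜 m)] {S : DescentSystem P A}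

variable (𝒜) in
/-- The Hilbert series of the quotient by a left ideal. -/
noncomputable def quotSeries (D : Submodule A A) : PowerSeries ℚ :=
  PowerSeries.mk fun m => (finrank F (𝒜 m) : ℚ) - finrank F (idealPart 𝒜 D m)

theorem quotSeries_bot : quotSeries 𝒜 (⊥ : Submodule A A) = hilbertSeries 𝒜 := by
  ext m
  rw [quotSeries, hilbertSeries, coeff_mk, coeff_mk, idealPart_bot, finrank_bot, Nat.cast_zero,
    sub_zero]

variable (hS : ∀ e, S.edge e ∈ 𝒜 1) {N : ℕ}
  (hN : ∀ y : P → A, y ⊤ = 0 → S.eval y = 0 → y ∈ S.relSpan N)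

include hS hN

theorem hilbertSeries_eq (hgen : ∀ m, ∀ a ∈ 𝒜 (m + 1), ∃ y : P → A, S.eval y = a)
    (h0 : finrank F (𝒜 0) = 1) :
    hilbertSeries 𝒜 = 1 + PowerSeries.X * ∑ v with v ≠ ⊤, quotSeries 𝒜 (S.coverIdeal v) := by
  ext m
  rw [hilbertSeries, coeff_mk, map_add]
  cases m with
  | zero => simp [h0]
  | succ m =>
    have h := congrArg (Nat.cast (R := ℚ)) (finrank_succ hS hN hgen m)
    push_cast at h
    rw [PowerSeries.coeff_succ_X_mul, map_sum, PowerSeries.coeff_one, if_neg (by omega), zero_add]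
    simp only [quotSeries, coeff_mk, Finset.sum_sub_distrib]
    linarith

-- In `finrank_diffIdeal_succ` the sum of the cover ideals is the difference ideal one layer up, by
-- `iSup_coverIdeal_eq`; this closes the recursion in `k`.
open Classical in
theorem quotSeries_diffIdeal_succ (hP : Uniform P) {v : P} {k : ℕ} (hk : k + 1 ≤ corank v) :
    quotSeries 𝒜 (S.diffIdeal fun u => v ≤ u ∧ corank u = k + 1) = hilbertSeries 𝒜 -
      PowerSeries.X * ∑ u with v ≤ u ∧ corank u = k + 1, quotSeries 𝒜 (S.coverIdeal u) +
      PowerSeries.X * quotSeries 𝒜 (S.diffIdeal fun u => v ≤ u ∧ corank u = k) := by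
  obtain ⟨u₀, hu₀⟩ := exists_le_corank_eq hk
  ext m
  rw [map_add, map_sub, hilbertSeries, quotSeries, coeff_mk, coeff_mk]
  cases m with
  | zero =>
    rw [idealPart_diffIdeal_zero hS, finrank_bot]
    · simp
    · rintro u ⟨-, hu⟩ rfl
      simp at hu
  | succ m =>
    have h := congrArg (Nat.cast (R := ℚ)) (finrank_diffIdeal_succ hS hN
      (p := fun u => v ≤ u ∧ corank u = k + 1) (fun u hu => hu.2) hu₀ m)
    rw [iSup_coverIdeal_eq hP] at h
    push_cast at h
    rw [PowerSeries.coeff_succ_X_mul, PowerSeries.coeff_succ_X_mul, map_sum]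
    simp only [quotSeries, coeff_mk, Finset.sum_sub_distrib]
    linarith

-- Iterate the recursion from corank 0 to `corank v`. At both ends a single vertex remains, ⊤ and
-- `v` respectively, so the difference ideal is zero and drops out.
open Classical in
theorem sum_quotSeries_coverIdeal (hP : Uniform P) (v : P) :
    ∑ u with v ≤ u ∧ u ≠ ⊤, PowerSeries.X ^ (corank v - corank u) *
      ((1 - PowerSeries.X) * quotSeries 𝒜 (S.coverIdeal u)) =
      (1 - PowerSeries.X ^ corank v) * hilbertSeries 𝒜 := by
  have key : ∀ k ≤ corank v,
      (1 - PowerSeries.X) * quotSeries 𝒜 (S.diffIdeal fun u => v ≤ u ∧ corank u = k) =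
      (1 - PowerSeries.X ^ (k + 1)) * hilbertSeries 𝒜 -
        PowerSeries.X * ∑ u with v ≤ u ∧ u ≠ ⊤ ∧ corank u ≤ k,
          PowerSeries.X ^ (k - corank u) *
            ((1 - PowerSeries.X) * quotSeries 𝒜 (S.coverIdeal u)) := by
    intro k hk
    induction k with
    | zero =>
      rw [diffIdeal_eq_bot, quotSeries_bot, Finset.sum_eq_zero]
      · ring
      · intro u hu
        obtain ⟨-, h1, h2⟩ := (Finset.mem_filter.1 hu).2
        exact absurd (corank_pos h1) (by omega)
      · rintro u u' ⟨-, h⟩ ⟨-, h'⟩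
        rw [corank_eq_zero_iff.1 h, corank_eq_zero_iff.1 h']
    | succ k ih =>
      have hsplit : (Finset.univ.filter fun u : P => v ≤ u ∧ u ≠ ⊤ ∧ corank u ≤ k + 1) =
          (Finset.univ.filter fun u : P => v ≤ u ∧ u ≠ ⊤ ∧ corank u ≤ k) ∪
          (Finset.univ.filter fun u : P => v ≤ u ∧ corank u = k + 1) := by
        ext u
        have : corank u = k + 1 → u ≠ ⊤ := by
          rintro h rfl
          simp at h
        simp only [Finset.mem_union, Finset.mem_filter, Finset.mem_univ, true_and]
        grind
      have hdisj : Disjoint (Finset.univ.filter fun u : P => v ≤ u ∧ u ≠ ⊤ ∧ corank u ≤ k)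
          (Finset.univ.filter fun u : P => v ≤ u ∧ corank u = k + 1) := by
        rw [Finset.disjoint_filter]
        intro u _ h h'
        omega
      have h1 : ∑ u with v ≤ u ∧ corank u = k + 1, PowerSeries.X ^ (k + 1 - corank u) *
          ((1 - PowerSeries.X) * quotSeries 𝒜 (S.coverIdeal u)) =
          (1 - PowerSeries.X) *
            ∑ u with v ≤ u ∧ corank u = k + 1, quotSeries 𝒜 (S.coverIdeal u) := by
        rw [Finset.mul_sum]
        refine Finset.sum_congr rfl fun u hu => ?_
        rw [(Finset.mem_filter.1 hu).2.2, Nat.sub_self, pow_zero, one_mul]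
      have h2 : ∑ u with v ≤ u ∧ u ≠ ⊤ ∧ corank u ≤ k, PowerSeries.X ^ (k + 1 - corank u) *
          ((1 - PowerSeries.X) * quotSeries 𝒜 (S.coverIdeal u)) =
          PowerSeries.X * ∑ u with v ≤ u ∧ u ≠ ⊤ ∧ corank u ≤ k,
            PowerSeries.X ^ (k - corank u) *
              ((1 - PowerSeries.X) * quotSeries 𝒜 (S.coverIdeal u)) := by
        rw [Finset.mul_sum]
        refine Finset.sum_congr rfl fun u hu => ?_
        rw [Nat.sub_add_comm (Finset.mem_filter.1 hu).2.2.2, pow_succ', mul_assoc]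
      rw [hsplit, Finset.sum_union hdisj, h1, h2, quotSeries_diffIdeal_succ hS hN hP hk]
      linear_combination PowerSeries.X * ih (by omega)
  have h := key (corank v) le_rfl
  rw [diffIdeal_eq_bot, quotSeries_bot] at h
  · have hfil : (Finset.univ.filter fun u : P => v ≤ u ∧ u ≠ ⊤ ∧ corank u ≤ corank v) =
        Finset.univ.filter fun u : P => v ≤ u ∧ u ≠ ⊤ := by
      ext u
      have := fun h : v ≤ u => corank_anti h
      simp only [Finset.mem_filter, Finset.mem_univ, true_and]
      grind
    rw [hfil] at h
    refine mul_left_cancel₀ (PowerSeries.X_ne_zero (R := ℚ)) ?_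
    linear_combination h
  · rintro u u' ⟨h1, h2⟩ ⟨h3, h4⟩
    have aux {w : P} (hw : v ≤ w) (hc : corank w = corank v) : v = w := by
      rcases hw.eq_or_lt with h | h
      · exact h
      · exact absurd (corank_lt h) (by omega)
    rw [← aux h1 h2, ← aux h3 h4]

open Classical in
/-- The Hilbert series of an algebra presented by the relations of a uniform poset, expressed through
a solution `r` of the system of equations `hr`. -/
theorem hilbertSeries_mul_eq (hP : Uniform P)
    (hgen : ∀ m, ∀ a ∈ 𝒜 (m + 1), ∃ y : P → A, S.eval y = a) (h0 : finrank F (𝒜 0) = 1)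
    (r : P → ℕ) (hr0 : r ⊤ = 0) (hr : ∀ v : P, ∑ u with v ≤ u,
      (PowerSeries.X : PowerSeries ℚ) ^ (corank v - corank u) * (1 - PowerSeries.X) ^ r u = 1) :
    hilbertSeries 𝒜 * (1 - PowerSeries.X * ∑ v : P, (1 - PowerSeries.X) ^ r v) =
      1 - PowerSeries.X := by
  have hr' (v : P) : ∑ u with v ≤ u ∧ u ≠ ⊤, (PowerSeries.X : PowerSeries ℚ) ^
      (corank v - corank u) * (1 - PowerSeries.X) ^ r u = 1 - PowerSeries.X ^ corank v := by
    have h := hr v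
    rw [← Finset.sum_filter_add_sum_filter_not (Finset.univ.filter fun u : P => v ≤ u) (· ≠ ⊤)] at h
    have : ((Finset.univ.filter fun u : P => v ≤ u).filter fun u => ¬ u ≠ ⊤) = {⊤} := by
      ext u
      simp only [Finset.mem_filter, Finset.mem_univ, true_and, not_not, Finset.mem_singleton]
      exact ⟨fun h => h.2, fun h => ⟨h ▸ le_top, h⟩⟩
    rw [this, Finset.sum_singleton, hr0, corank_top, Nat.sub_zero, pow_zero, mul_one,
      Finset.filter_filter] at h
    exact eq_sub_of_add_eq h
  -- The system is triangular for the order, with diagonal coefficient 1, so the solution supplied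
  -- by `r` is the only one.
  have key (v : P) (hv : v ≠ ⊤) : (1 - PowerSeries.X) * quotSeries 𝒜 (S.coverIdeal v) =
      (1 - PowerSeries.X) ^ r v * hilbertSeries 𝒜 := by
    induction v using WellFoundedGT.induction with
    | ind v ih =>
      have h1 := sum_quotSeries_coverIdeal hS hN hP v
      rw [← hr' v, Finset.sum_mul] at h1
      have hmem : v ∈ Finset.univ.filter fun u : P => v ≤ u ∧ u ≠ ⊤ := by simp [hv]
      rw [← Finset.add_sum_erase _ _ hmem, ← Finset.add_sum_erase _ _ hmem] at h1
      have h2 : ∑ u ∈ (Finset.univ.filter fun u : P => v ≤ u ∧ u ≠ ⊤).erase v,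
          PowerSeries.X ^ (corank v - corank u) *
            ((1 - PowerSeries.X) * quotSeries 𝒜 (S.coverIdeal u)) =
          ∑ u ∈ (Finset.univ.filter fun u : P => v ≤ u ∧ u ≠ ⊤).erase v,
          PowerSeries.X ^ (corank v - corank u) * (1 - PowerSeries.X) ^ r u *
            hilbertSeries 𝒜 := by
        refine Finset.sum_congr rfl fun u hu => ?_
        obtain ⟨h3, h4⟩ := Finset.mem_erase.1 hu
        obtain ⟨h5, h6⟩ := (Finset.mem_filter.1 h4).2
        rw [ih u (lt_of_le_of_ne h5 (Ne.symm h3)) h6, mul_assoc]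
      rw [h2] at h1
      have h3 := add_right_cancel h1
      rwa [Nat.sub_self, pow_zero, one_mul, one_mul] at h3
  have h1 := hilbertSeries_eq hS hN hgen h0
  have h2 : (1 - PowerSeries.X) * ∑ v with v ≠ ⊤, quotSeries 𝒜 (S.coverIdeal v) =
      (∑ v : P with v ≠ ⊤, (1 - PowerSeries.X) ^ r v) * hilbertSeries 𝒜 := by
    rw [Finset.mul_sum, Finset.sum_mul]
    exact Finset.sum_congr rfl fun v hv => key v (Finset.mem_filter.1 hv).2
  -- The term of ⊤ is 1; it accounts for the `X` in the factor `1 - X` multiplying the Hilbert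
  -- series.
  have h3 : ∑ v : P, (1 - PowerSeries.X : PowerSeries ℚ) ^ r v =
      ∑ v : P with v ≠ ⊤, (1 - PowerSeries.X) ^ r v + 1 := by
    rw [← Finset.sum_filter_add_sum_filter_not Finset.univ (· ≠ (⊤ : P))]
    congr 1
    have : (Finset.univ.filter fun u : P => ¬ u ≠ ⊤) = {⊤} := by
      ext u
      simp
    rw [this, Finset.sum_singleton, hr0, pow_zero]
  rw [h3]
  linear_combination (1 - PowerSeries.X) * h1 + PowerSeries.X * h2

end HilbertSeries

end DescentSystem

namespace SplittingAlgebra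

variable (F : Type*) [Field F] (P : Type*) [PartialOrder P] [OrderTop P] [RankedPoset P] [Fintype P]

theorem edge_mem_splittingDegree (e : HasseEdge P) : edge F e ∈ splittingDegree F P 1 :=
  mk_mem_splittingDegree F P (ι_mem_freeDegree F P e)

theorem finrank_splittingDegree_zero : finrank F (splittingDegree F P 0) = 1 := by
  classical
  have h : splittingDegree F P 0 = Submodule.span F {1} := by
    rw [splittingDegree, freeDegree, pow_zero, Submodule.one_eq_span, Submodule.map_span,
      Set.image_singleton, AlgHom.toLinearMap_apply, map_one]
  rw [h]
  exact finrank_span_singleton one_ne_zero'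

/-- A word of positive length ends in an edge, which is a difference of two vertex elements. -/
theorem exists_eval_eq [DecidableEq P] (m : ℕ) (a : SplittingAlgebra F P)
    (ha : a ∈ splittingDegree F P (m + 1)) : ∃ y, (descentSystem F P).eval y = a := by
  obtain ⟨x, hx, rfl⟩ := ha
  rw [SetLike.mem_coe, freeDegree, pow_succ] at hx
  rw [AlgHom.toLinearMap_apply]
  induction hx using Submodule.mul_induction_on' with
  | mem_mul_mem x hx b hb =>
    have hb' : ∃ y, (descentSystem F P).eval y = RingQuot.mkAlgHom F (SplittingRel F P) b := by
      induction hb using Submodule.span_induction with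
      | mem b hb =>
        obtain ⟨e, rfl⟩ := hb
        refine ⟨DescentSystem.unitVec _ e.tail - DescentSystem.unitVec _ e.head, ?_⟩
        rw [map_sub, DescentSystem.eval_unitVec, DescentSystem.eval_unitVec]
        exact ((descentSystem F P).edge_eq e).symm
      | zero => exact ⟨0, by rw [map_zero, map_zero]⟩
      | add b c _ _ hb hc =>
        obtain ⟨y, hy⟩ := hb
        obtain ⟨z, hz⟩ := hc
        exact ⟨y + z, by rw [map_add, map_add, hy, hz]⟩
      | smul c b _ hb =>
        obtain ⟨y, hy⟩ := hb
        refine ⟨(algebraMap F (SplittingAlgebra F P) c) • y, ?_⟩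
        rw [map_smul, map_smul, hy, smul_eq_mul, Algebra.smul_def]
    obtain ⟨y, hy⟩ := hb'
    exact ⟨RingQuot.mkAlgHom F (SplittingRel F P) x • y, by rw [map_smul, hy, smul_eq_mul, map_mul]⟩
  | add x _ y _ hx hy =>
    obtain ⟨x', hx⟩ := hx
    obtain ⟨y', hy⟩ := hy
    exact ⟨x' + y', by rw [map_add, map_add, hx, hy]⟩

open Classical in
/-- The Hilbert series of the splitting algebra of a uniform poset. -/
theorem hilbertSeries_mul_eq (hP : Uniform P) (r : P → ℕ) (hr0 : r ⊤ = 0)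
    (hr : ∀ v : P, ∑ u with v ≤ u,
      (PowerSeries.X : PowerSeries ℚ) ^ (corank v - corank u) * (1 - PowerSeries.X) ^ r u = 1) :
    hilbertSeries (splittingDegree F P) *
      (1 - PowerSeries.X * ∑ v : P, (1 - PowerSeries.X) ^ r v) = 1 - PowerSeries.X :=
  DescentSystem.hilbertSeries_mul_eq (S := descentSystem F P) (edge_mem_splittingDegree F P)
    (fun _ => mem_relSpan_of_eval_eq_zero) hP (exists_eval_eq F P)
    (finrank_splittingDegree_zero F P) r hr0 hr

end SplittingAlgebra

end

/-! ### The divisor poset: two divisor sums and uniformity. -/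

section

open RankedPoset

section Arithmetic

open ArithmeticFunction PowerSeries

/-- The arithmetic function `n ↦ X ^ Ω(n)`. -/
noncomputable def powCardFactors : ArithmeticFunction (PowerSeries ℚ) :=
  ⟨fun n => if n = 0 then 0 else X ^ cardFactors n, if_pos rfl⟩

/-- The arithmetic function `n ↦ (1 - X) ^ ω(n)`. -/
noncomputable def powCardDistinctFactors : ArithmeticFunction (PowerSeries ℚ) :=
  ⟨fun n => if n = 0 then 0 else (1 - X) ^ cardDistinctFactors n, if_pos rfl⟩

theorem powCardFactors_apply {n : ℕ} (hn : n ≠ 0) : powCardFactors n = X ^ cardFactors n :=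
  if_neg hn

theorem powCardDistinctFactors_apply {n : ℕ} (hn : n ≠ 0) :
    powCardDistinctFactors n = (1 - X) ^ cardDistinctFactors n :=
  if_neg hn

theorem isMultiplicative_powCardFactors : powCardFactors.IsMultiplicative := by
  refine IsMultiplicative.iff_ne_zero.2 ⟨?_, fun {m n} hm hn _ => ?_⟩
  · simp [powCardFactors_apply]
  · rw [powCardFactors_apply hm, powCardFactors_apply hn, powCardFactors_apply (mul_ne_zero hm hn),
      cardFactors_mul hm hn, pow_add]

theorem isMultiplicative_powCardDistinctFactors : powCardDistinctFactors.IsMultiplicative := by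
  refine IsMultiplicative.iff_ne_zero.2 ⟨?_, fun {m n} hm hn h => ?_⟩
  · simp [powCardDistinctFactors_apply]
  · rw [powCardDistinctFactors_apply hm, powCardDistinctFactors_apply hn,
      powCardDistinctFactors_apply (mul_ne_zero hm hn), cardDistinctFactors_mul h, pow_add]

/-- By multiplicativity it suffices to look at p^k, where the sum telescopes: (1 - X)(1 + X + ⋯ +
X^(k-1)) + X^k = 1. -/
theorem powCardFactors_mul_powCardDistinctFactors :
    powCardFactors * powCardDistinctFactors = (zeta : ArithmeticFunction (PowerSeries ℚ)) := by
  rw [IsMultiplicative.eq_iff_eq_on_prime_powers _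
    (isMultiplicative_powCardFactors.mul isMultiplicative_powCardDistinctFactors) _
    isMultiplicative_zeta.natCast]
  intro p k hp
  have hpk := fun i => pow_ne_zero i hp.ne_zero
  rw [mul_apply, Nat.sum_divisorsAntidiagonal fun a b => powCardFactors a * powCardDistinctFactors b,
    Nat.sum_divisors_prime_pow hp, Finset.sum_range_succ, natCoe_apply, zeta_apply_ne (hpk k)]
  have h : ∀ i ∈ Finset.range k, powCardFactors (p ^ i) * powCardDistinctFactors (p ^ k / p ^ i) =
      (1 - X) * X ^ i := by
    intro i hi
    rw [Finset.mem_range] at hi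
    rw [Nat.pow_div hi.le hp.pos, powCardFactors_apply (hpk _), powCardDistinctFactors_apply (hpk _),
      cardFactors_apply_prime_pow hp, cardDistinctFactors_apply_prime_pow hp (by omega), pow_one,
      mul_comm]
  rw [Finset.sum_congr rfl h, ← Finset.mul_sum, mul_neg_geom_sum, Nat.div_self (pow_pos hp.pos k),
    isMultiplicative_powCardDistinctFactors.map_one, mul_one, powCardFactors_apply (hpk _),
    cardFactors_apply_prime_pow hp]
  simp

/-- The divisor sum is multiplicative, and over p^s it is 1 plus s equal terms 1 - X. -/
theorem sum_divisors_powCardDistinctFactors {k : ℕ} (p s : Fin k → ℕ) (hp : ∀ j, (p j).Prime)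
    (hinj : Function.Injective p) :
    ∑ d ∈ (∏ j, p j ^ s j).divisors, powCardDistinctFactors d =
      ∏ j, (1 + (s j : PowerSeries ℚ) * (1 - X)) := by
  rw [← coe_zeta_mul_apply, IsMultiplicative.map_prod _
    (isMultiplicative_zeta.natCast.mul isMultiplicative_powCardDistinctFactors)]
  · refine Finset.prod_congr rfl fun j _ => ?_
    have hpk := fun i => pow_ne_zero i (hp j).ne_zero
    rw [coe_zeta_mul_apply, Nat.sum_divisors_prime_pow (hp j), Finset.sum_range_succ', pow_zero,
      isMultiplicative_powCardDistinctFactors.map_one, add_comm]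
    congr 1
    rw [Finset.sum_congr rfl fun i _ => by
      rw [powCardDistinctFactors_apply (hpk _), cardDistinctFactors_apply_prime_pow (hp j)
        (Nat.succ_ne_zero i), pow_one], Finset.sum_const, Finset.card_range, nsmul_eq_mul]
  · intro i _ j _ hij
    exact Nat.Coprime.pow _ _ ((Nat.coprime_primes (hp i) (hp j)).2 (hinj.ne hij))

end Arithmetic

namespace Factors

variable {n : ℕ}

theorem val_dvd (a : Factors n) : a.val ∣ n := Nat.dvd_of_mem_divisors a.mem

theorem le_iff {a b : Factors n} : a ≤ b ↔ a.val ∣ b.val := Iff.rfl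

noncomputable instance : Fintype (Factors n) := Fintype.ofFinite _

/-- The factors of `n` are the elements of the set of divisors of `n`. -/
def equivDivisors (n : ℕ) : Factors n ≃ n.divisors where
  toFun a := ⟨a.val, a.mem⟩
  invFun a := ⟨a.1, a.2⟩

theorem sum_eq_sum_divisors {M : Type*} [AddCommMonoid M] (f : ℕ → M) :
    ∑ a : Factors n, f a.val = ∑ d ∈ n.divisors, f d := by
  rw [← Finset.sum_coe_sort n.divisors]
  exact (equivDivisors n).sum_comp fun d => f d

variable [NeZero n]

instance : OrderTop (Factors n) where
  top := ⟨n, Nat.mem_divisors_self n (NeZero.ne n)⟩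
  le_top a := a.val_dvd

/-- A divisor of `n` as a factor of `n`. -/
def ofDvd {d : ℕ} (h : d ∣ n) : Factors n := ⟨d, Nat.mem_divisors.2 ⟨h, NeZero.ne n⟩⟩

@[simp] theorem top_val : (⊤ : Factors n).val = n := rfl

theorem rank_eq (a : Factors n) : RankedPoset.rank a = ArithmeticFunction.cardFactors a.val := rfl

theorem covBy_of_val_eq_mul_prime {a b : Factors n} {p : ℕ} (hp : p.Prime)
    (h : b.val = a.val * p) : a ⋖ b := by
  have hab : a ≤ b := le_iff.2 (h ▸ Dvd.intro p rfl)
  have hne : a ≠ b := by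
    rintro rfl
    exact hp.ne_one (Nat.eq_of_mul_eq_mul_left (Nat.pos_of_ne_zero a.val_ne_zero)
      (by rw [mul_one]; exact h.symm))
  refine ⟨lt_of_le_of_ne hab hne, fun c hac hcb => ?_⟩
  obtain ⟨x, hx⟩ := le_iff.1 hac.le
  have h1 : x ∣ p := by
    have h2 := le_iff.1 hcb.le
    rw [hx, h] at h2
    exact Nat.dvd_of_mul_dvd_mul_left (Nat.pos_of_ne_zero a.val_ne_zero) h2
  rcases (Nat.dvd_prime hp).1 h1 with rfl | rfl
  · exact hac.ne (ext_val (by rw [hx, mul_one]))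
  · exact hcb.ne (ext_val (by rw [hx, h]))

theorem cardFactors_eq_of_corank_eq {a b : Factors n} (h : corank a = corank b) :
    ArithmeticFunction.cardFactors a.val = ArithmeticFunction.cardFactors b.val := by
  have h1 := rank_le_rank_top a
  have h2 := rank_le_rank_top b
  unfold corank at h
  rw [← rank_eq, ← rank_eq]
  omega

/-- Write u = ga and u' = gb with a, b coprime and Ω(a) = Ω(b), and trade one prime p of a for a
prime q of b at a time. Every step keeps the factor g, hence stays above v. -/
theorem uniform : Uniform (Factors n) := by
  intro v u u' hu hu' hc
  have key : ∀ (k g a b : ℕ) (u : Factors n), u.val = g * a → u'.val = g * b → a.Coprime b →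
      ArithmeticFunction.cardFactors a = k → ArithmeticFunction.cardFactors b = k → v.val ∣ g →
      Relation.ReflTransGen (Linked v) u u' := by
    intro k
    induction k with
    | zero =>
      intro g a b u hu hu' _ ha hb _
      have ha' : a ≠ 0 := by rintro rfl; exact u.val_ne_zero (by rw [hu, mul_zero])
      have hb' : b ≠ 0 := by rintro rfl; exact u'.val_ne_zero (by rw [hu', mul_zero])
      rw [ArithmeticFunction.cardFactors_eq_zero_iff_eq_zero_or_one] at ha hb
      have : u = u' := ext_val (by rw [hu, hu', ha.resolve_left ha', hb.resolve_left hb'])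
      rw [this]
    | succ k ih =>
      intro g a b u hu hu' hab ha hb hv
      have ha1 : a ≠ 1 := by rintro rfl; simp at ha
      have hb1 : b ≠ 1 := by rintro rfl; simp at hb
      obtain ⟨p, hp, a, rfl⟩ := Nat.exists_prime_and_dvd ha1
      obtain ⟨q, hq, b, rfl⟩ := Nat.exists_prime_and_dvd hb1
      have hpa : p * a ≠ 0 := fun h => u.val_ne_zero (by rw [hu, h, mul_zero])
      have hqb : q * b ≠ 0 := fun h => u'.val_ne_zero (by rw [hu', h, mul_zero])
      -- By coprimality this product is the least common multiple of u and u'. It ensures that the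
      -- common upper cover, u times q, still divides n.
      have hdvd : g * (p * a) * (q * b) ∣ n := by
        obtain ⟨t, ht⟩ := hu ▸ u.val_dvd
        have h1 : q * b ∣ n := (Dvd.intro_left g hu'.symm).trans u'.val_dvd
        have h2 := hu' ▸ u'.val_dvd
        have hg : 0 < g := Nat.pos_of_ne_zero fun h => u.val_ne_zero (by rw [hu, h, zero_mul])
        rw [ht, mul_assoc] at h2
        have h3 := Nat.dvd_of_mul_dvd_mul_left hg h2
        rw [ht]
        exact mul_dvd_mul_left _ (hab.symm.dvd_of_dvd_mul_left h3)
      have hw : g * (p * a) * q ∣ n := (mul_dvd_mul_left _ (Dvd.intro b rfl)).trans hdvd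
      have hc : g * q * a ∣ n := (Dvd.intro p (by ring)).trans hw
      have hm : g * a ∣ n := (Dvd.intro (p * q) (by ring)).trans hw
      have hlink : Linked v u (ofDvd hc) := by
        refine ⟨⟨ofDvd hw, covBy_of_val_eq_mul_prime hq (by rw [hu]; rfl),
          covBy_of_val_eq_mul_prime hp ?_⟩, ofDvd hm, hv.trans (Dvd.intro a rfl),
          covBy_of_val_eq_mul_prime hp ?_, covBy_of_val_eq_mul_prime hq ?_⟩
        · change g * (p * a) * q = g * q * a * p
          ring
        · change u.val = g * a * p
          rw [hu]
          ring
        · change g * q * a = g * a * q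
          ring
      refine Relation.ReflTransGen.head hlink
        (ih (g * q) a b (ofDvd hc) rfl (by rw [hu']; ring) ?_ ?_ ?_ (hv.trans (Dvd.intro q rfl)))
      · exact hab.coprime_mul_left.coprime_mul_left_right
      · rw [ArithmeticFunction.cardFactors_mul hp.ne_zero (right_ne_zero_of_mul hpa),
          ArithmeticFunction.cardFactors_apply_prime hp] at ha
        omega
      · rw [ArithmeticFunction.cardFactors_mul hq.ne_zero (right_ne_zero_of_mul hqb),
          ArithmeticFunction.cardFactors_apply_prime hq] at hb
        omega
  have hpos : 0 < u.val.gcd u'.val := Nat.gcd_pos_of_pos_left _ (Nat.pos_of_ne_zero u.val_ne_zero)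
  obtain ⟨a, ha⟩ := Nat.gcd_dvd_left u.val u'.val
  obtain ⟨b, hb⟩ := Nat.gcd_dvd_right u.val u'.val
  have hcop : a.Coprime b := by
    have h := Nat.coprime_div_gcd_div_gcd hpos
    rwa [Nat.div_eq_of_eq_mul_right hpos ha, Nat.div_eq_of_eq_mul_right hpos hb] at h
  have hcard := cardFactors_eq_of_corank_eq hc
  have ha0 : a ≠ 0 := by rintro rfl; exact u.val_ne_zero (by rw [ha, mul_zero])
  have hb0 : b ≠ 0 := by rintro rfl; exact u'.val_ne_zero (by rw [hb, mul_zero])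
  have h1 := congrArg ArithmeticFunction.cardFactors ha
  have h2 := congrArg ArithmeticFunction.cardFactors hb
  rw [ArithmeticFunction.cardFactors_mul hpos.ne' ha0] at h1
  rw [ArithmeticFunction.cardFactors_mul hpos.ne' hb0] at h2
  exact key _ _ a b u ha hb hcop rfl (by omega) (Nat.dvd_gcd hu hu')

-- With n = v d, the u above v are the v a with ab = d; then the corank difference is Ω(a) and n/u =
-- b, so the sum is the convolution identity at d.
open Classical in
theorem sum_pow_cardDistinctFactors (v : Factors n) : ∑ u with v ≤ u,
    (PowerSeries.X : PowerSeries ℚ) ^ (corank v - corank u) *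
      (1 - PowerSeries.X) ^ ArithmeticFunction.cardDistinctFactors (n / u.val) = 1 := by
  obtain ⟨d, hd⟩ := v.val_dvd
  have hd0 : d ≠ 0 := by
    rintro rfl
    exact NeZero.ne n (by rw [hd, mul_zero])
  have h1 : (powCardFactors * powCardDistinctFactors) d = 1 := by
    rw [powCardFactors_mul_powCardDistinctFactors, ArithmeticFunction.natCoe_apply,
      ArithmeticFunction.zeta_apply_ne hd0, Nat.cast_one]
  rw [ArithmeticFunction.mul_apply] at h1
  refine Eq.trans (Eq.symm ?_) h1
  have hdvd {a b : ℕ} (h : (a, b) ∈ d.divisorsAntidiagonal) : v.val * a ∣ n := by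
    refine Dvd.intro b (hd.trans ?_).symm
    rw [← (Nat.mem_divisorsAntidiagonal.1 h).1, mul_assoc]
  refine Finset.sum_bij (fun x hx => ofDvd (hdvd (b := x.2) hx)) ?_ ?_ ?_ ?_
  · intro x hx
    simp only [Finset.mem_filter, Finset.mem_univ, true_and]
    exact Dvd.intro x.1 rfl
  · intro x hx y hy h
    have h2 : v.val * x.1 = v.val * y.1 := congrArg Factors.val h
    have h3 := Nat.eq_of_mul_eq_mul_left (Nat.pos_of_ne_zero v.val_ne_zero) h2
    have h4 := (Nat.mem_divisorsAntidiagonal.1 hx).1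
    have h5 := (Nat.mem_divisorsAntidiagonal.1 hy).1
    have h6 : x.1 ≠ 0 := fun h => hd0 (by rw [← h4, h, zero_mul])
    rw [← h5, ← h3] at h4
    exact Prod.ext h3 (Nat.eq_of_mul_eq_mul_left (Nat.pos_of_ne_zero h6) h4)
  · intro u hu
    obtain ⟨a, ha⟩ := le_iff.1 (Finset.mem_filter.1 hu).2
    obtain ⟨b, hb⟩ := u.val_dvd
    refine ⟨(a, b), Nat.mem_divisorsAntidiagonal.2 ⟨?_, hd0⟩, ext_val ha.symm⟩
    refine Nat.eq_of_mul_eq_mul_left (Nat.pos_of_ne_zero v.val_ne_zero) ?_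
    exact (hd.symm.trans (hb.trans (by rw [ha, mul_assoc]))).symm
  · rintro ⟨a, b⟩ hx
    have h4 := (Nat.mem_divisorsAntidiagonal.1 hx).1
    simp only at h4
    have ha : a ≠ 0 := fun h => hd0 (by rw [← h4, h, zero_mul])
    have hb : b ≠ 0 := fun h => hd0 (by rw [← h4, h, mul_zero])
    have h5 : (ofDvd (hdvd hx) : Factors n).val = v.val * a := rfl
    have h6 : n / (v.val * a) = b :=
      Nat.div_eq_of_eq_mul_right (Nat.pos_of_ne_zero (mul_ne_zero v.val_ne_zero ha))
        (hd.trans (by rw [mul_assoc, h4]))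
    have h7 : corank v - corank (ofDvd (hdvd hx) : Factors n) =
        ArithmeticFunction.cardFactors a := by
      have h8 := rank_le_rank_top (ofDvd (hdvd hx) : Factors n)
      have h9 := ArithmeticFunction.cardFactors_mul v.val_ne_zero ha
      have h10 := rank_le_rank_top v
      have h11 : RankedPoset.rank (ofDvd (hdvd hx) : Factors n) =
        ArithmeticFunction.cardFactors (v.val * a) := rfl
      have h12 : RankedPoset.rank v = ArithmeticFunction.cardFactors v.val := rfl
      unfold corank
      omega
    rw [h7, h5, h6, powCardFactors_apply ha, powCardDistinctFactors_apply hb]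

end Factors

end

theorem theorem6p1 (F : Type*) [Field F] (n k : ℕ) (p s : Fin k → ℕ)
    (hp : ∀ j, (p j).Prime) (hinj : Function.Injective p) (hn : n = ∏ j, p j ^ s j) :
    hilbertSeries (splittingDegree F (Factors n)) =
      (1 - PowerSeries.X) *
        (1 - PowerSeries.X * ∏ j, (1 + (s j : PowerSeries ℚ) * (1 - PowerSeries.X)))⁻¹ := by
  have hn0 : n ≠ 0 := by
    rw [hn]
    exact Finset.prod_ne_zero_iff.2 fun j _ => pow_ne_zero _ (hp j).ne_zero
  have : NeZero n := ⟨hn0⟩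
  have h := SplittingAlgebra.hilbertSeries_mul_eq F (Factors n) Factors.uniform
    (fun v => ArithmeticFunction.cardDistinctFactors (n / v.val)) 
    (by rw [Factors.top_val, Nat.div_self (Nat.pos_of_ne_zero hn0),
      ArithmeticFunction.cardDistinctFactors_one])
    Factors.sum_pow_cardDistinctFactors
  have h1 : ∑ v : Factors n, (1 - PowerSeries.X : PowerSeries ℚ) ^
      ArithmeticFunction.cardDistinctFactors (n / v.val) =
      ∏ j, (1 + (s j : PowerSeries ℚ) * (1 - PowerSeries.X)) := by
    rw [← sum_divisors_powCardDistinctFactors p s hp hinj, ← hn,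
      -- The involution d ↦ n/d on the divisors removes the quotient from the exponent.
      ← Nat.sum_div_divisors n powCardDistinctFactors, ← Factors.sum_eq_sum_divisors]
    refine Finset.sum_congr rfl fun v _ => (powCardDistinctFactors_apply ?_).symm
    exact (Nat.div_pos (Nat.le_of_dvd (Nat.pos_of_ne_zero hn0) v.val_dvd)
      (Nat.pos_of_ne_zero v.val_ne_zero)).ne'
  rw [h1] at h
  -- Dividing is legitimate because the denominator has constant coefficient 1, the side goal left
  -- to `simp`.
  rw [PowerSeries.eq_mul_inv_iff_mul_eq, h]
  simp
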